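/- Let $k$ be a field of characteristic different from $2$ and $3$, let $\Gamma$ be an abelian group, and let $\varepsilon:\Gamma\times\Gamma\to k\setminus\{0\}$ be a commutation factor, that is, $\varepsilon$ is multiplicative in each argument and $\varepsilon(\alpha,\beta)\varepsilon(\beta,\alpha)=1$. Let $g=\bigoplus_{\gamma\in\Gamma}g_\gamma$ be a finite-dimensional color Lie algebra over $k$: a $\Gamma$-graded vector space with a bilinear bracket such that, for $a\in g_\alpha$, $b\in g_\beta$, $c\in g_\gamma$, $$\langle a,b\rangle\in g_{\alpha+\beta},\qquad \langle a,b\rangle=-\varepsilon(\alpha,\beta)\langle b,a\rangle,$$ $$\varepsilon(\gamma,\alpha)\langle a,\langle b,c\rangle\rangle+\varepsilon(\beta,\gamma)\langle c,\langle a,b\rangle\rangle+\varepsilon(\alpha,\beta)\langle b,\langle c,a\rangle\rangle=0.$$ Let $R\subset g\oplus(g\otimes g)\subset T(g)$ be the linear span of the elements $a\otimes b-\varepsilon(\alpha,\beta)\,b\otimes a-\langle a,b\rangle$ with $a\in g_\alpha$, $b\in g_\beta$, let $I$ be the two-sided ideal of $T(g)$ generated by $R$, and let $U(g)=T(g)/I$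 be the universal enveloping algebra. Write $U(g)^0$ for the quotient of $T(g)$ by the ideal generated by the projection of $R$ on $g\otimes g$, and $\operatorname{gr}U(g)$ for the associated graded algebra of $U(g)$ with respect to the filtration by total degree in $g$. A graded algebra $B=\bigoplus_{m\ge0}B_m$ with finite-dimensional components, $B_0=k$, and generated by $B_1$ is called Koszul if the trivial graded right module $B/B_+$ has a linear free resolution, that is, a graded free resolution whose $i$-th term is free of finite rank with generators in degree $i$. Then: 1. $U(g)$ is almost quadratic with space of generators $g$ and space of relations $R$: the map $g\to U(g)$ is injective, $U(g)$ has an augmentation $U(g)\to k$ whose kernel is the two-sided ideal generated by $g$, and $U(g)=T(g)/(R)$ with $R\subset g\oplus (g\otimes g)$. 2. $U(g)$ is a PBW algebra: for some bases $v_1,\dots,v_n$ of $g$ and $r_1,\dots,r_m$ of $R$, the set $\{r_1,\dots,r_m\}$ is a Gröbner basis of $I$ for the degree-lexicographical order with $v_1>\dots>v_n$. More precisely, for every basis $v_1,\dots,v_n$ of $g$ consisting of homogeneous elements, $v_i\in g_{\gamma_i}$, the elements $$v_iv_j-\varepsilon(\gamma_i,\gamma_j)\,v_jv_i-\langle v_i,v_j\rangle\qquad(i<j,\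 \text{or } i=j \text{ and } \varepsilon(\gamma_i,\gamma_i)=-1)$$ form a basis of $R$ and a Gröbner basis of $I$ for this order. 3. $U(g)$ is a (nonhomogeneous) Koszul algebra: the graded algebras $U(g)^0$ and $\operatorname{gr}U(g)$ are isomorphic, by an isomorphism of graded algebras that is the identity on $g$, and both are Koszul. 4. Let $g_{\mathrm{ab}}$ be the abelian color Lie algebra (zero bracket) with the same graded vector space and the same commutation factor as $g$. Then $\operatorname{gr}U(g)$ and $U(g)^0$ are isomorphic to $U(g_{\mathrm{ab}})$ as graded algebras, by isomorphisms that are the identity on $g$, where $U(g_{\mathrm{ab}})$ is graded by total degree in $g$. -/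

import Mathlib

open scoped DirectSum

/-! ### Commutation factors and color Lie algebras -/

/-- A commutation factor on the abelian group `Γ` with values in `k \ {0}`. -/
structure CommutationFactor (k Γ : Type*) [Field k] [AddCommGroup Γ] where
  toFun : Γ → Γ → kˣ
  add_left : ∀ α β γ, toFun (α + β) γ = toFun α γ * toFun β γ
  add_right : ∀ α β γ, toFun α (β + γ) = toFun α β * toFun α γ
  mul_swap : ∀ α β, toFun α β * toFun β α = 1

instance {k Γ : Type*} [Field k] [AddCommGroup Γ] :
    CoeFun (CommutationFactor k Γ) (fun _ => Γ → Γ → kˣ) := ⟨CommutationFactor.toFun⟩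

/-- The structure of a `Γ`-graded `ε`-Lie algebra (color Lie algebra) on the vector space `g`. -/
structure ColorLieAlgebra {k Γ : Type*} [Field k] [AddCommGroup Γ] (ε : CommutationFactor k Γ)
    (g : Type*) [AddCommGroup g] [Module k g] where
  /-- the homogeneous components -/
  comp : Γ → Submodule k g
  /-- the space is the (internal) direct sum of its components -/
  comp_indep : iSupIndep comp
  comp_iSup : ⨆ γ, comp γ = ⊤
  /-- the bracket -/
  bracket : g →ₗ[k] g →ₗ[k] g
  bracket_mem : ∀ {α β : Γ} {a b : g}, a ∈ comp α → b ∈ comp β → bracket a b ∈ comp (α + β)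
  bracket_skew : ∀ {α β : Γ} {a b : g}, a ∈ comp α → b ∈ comp β →
    bracket a b = -((ε α β : k) • bracket b a)
  jacobi : ∀ {α β γ : Γ} {a b c : g}, a ∈ comp α → b ∈ comp β → c ∈ comp γ →
    (ε γ α : k) • bracket a (bracket b c) + (ε β γ : k) • bracket c (bracket a b)
      + (ε α β : k) • bracket b (bracket c a) = 0

namespace ColorLieAlgebra

variable {k Γ : Type*} [Field k] [AddCommGroup Γ] {ε : CommutationFactor k Γ}
  {g : Type*} [AddCommGroup g] [Module k g] (L : ColorLieAlgebra ε g)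

/-- The abelian color Lie algebra on the same graded space, with the same commutation factor. -/
def abelian : ColorLieAlgebra ε g where
  comp := L.comp
  comp_indep := L.comp_indep
  comp_iSup := L.comp_iSup
  bracket := 0
  bracket_mem _ _ := by simp
  bracket_skew _ _ := by simp
  jacobi _ _ _ := by simp

/-- The element `a b - ε(α, β) b a - ⟨a, b⟩` of the tensor algebra. -/
noncomputable def commRel (α β : Γ) (a b : g) : TensorAlgebra k g :=
  TensorAlgebra.ι k a * TensorAlgebra.ι k b
    - (ε α β : k) • (TensorAlgebra.ι k b * TensorAlgebra.ι k a)
    - TensorAlgebra.ι k (L.bracket a b)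

/-- The space of defining relations of the universal enveloping algebra. -/
noncomputable def relations : Submodule k (TensorAlgebra k g) :=
  Submodule.span k {x | ∃ α β : Γ, ∃ a ∈ L.comp α, ∃ b ∈ L.comp β, x = L.commRel α β a b}

/-- The relations `ab = ε(α, β) ba + ⟨a, b⟩` for homogeneous `a`, `b`. -/
inductive EnvRel : TensorAlgebra k g → TensorAlgebra k g → Prop
  | comm {α β : Γ} {a b : g} (ha : a ∈ L.comp α) (hb : b ∈ L.comp β) :
      EnvRel (TensorAlgebra.ι k a * TensorAlgebra.ι k b)
        ((ε α β : k) • (TensorAlgebra.ι k b * TensorAlgebra.ι k a)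
          + TensorAlgebra.ι k (L.bracket a b))

/-- The universal enveloping algebra `U(g)`. -/
abbrev Env := RingQuot L.EnvRel

/-- The canonical map `g → U(g)`. -/
noncomputable def envι : g →ₗ[k] L.Env :=
  (RingQuot.mkAlgHom k L.EnvRel).toLinearMap ∘ₗ TensorAlgebra.ι k

/-- For a basis `b` of homogeneous elements of degrees `deg`, the pairs `i < j`, together with the
pairs `i = j` for which `ε(deg i, deg i) = -1`. For the other diagonal pairs the relation
`b i b i - ε b i b i - ⟨b i, b i⟩` is zero in characteristic different from `2`. -/
abbrev RelIndex (ε : CommutationFactor k Γ) {n : ℕ} (deg : Fin n → Γ) : Type :=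
  {p : Fin n × Fin n // p.1 < p.2 ∨ (p.1 = p.2 ∧ (ε (deg p.1) (deg p.1) : k) = -1)}

/-- The defining relations `b i b j - ε(deg i, deg j) b j b i - ⟨b i, b j⟩` attached to a
homogeneous basis. -/
noncomputable def basisRel {n : ℕ} (b : Module.Basis (Fin n) k g) (deg : Fin n → Γ) :
    RelIndex ε deg → TensorAlgebra k g :=
  fun p => L.commRel (deg p.1.1) (deg p.1.2) (b p.1.1) (b p.1.2)

end ColorLieAlgebra

/-! ### Groebner bases in the tensor algebra -/

section Groebner

variable {k V : Type*} [Field k] [AddCommGroup V] [Module k V] {n : ℕ}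

/-- The degree-lexicographical order on words in `v_0, …, v_{n-1}` with `v_0 > ⋯ > v_{n-1}`. -/
def DegLexLT (u w : FreeMonoid (Fin n)) : Prop :=
  List.Shortlex (fun i j : Fin n => j < i) u.toList w.toList

/-- `w` is the leading monomial of `f`, monomials being taken in the basis `b` of `V`. -/
def IsLeadingMonomial (b : Module.Basis (Fin n) k V) (f : TensorAlgebra k V)
    (w : FreeMonoid (Fin n)) : Prop :=
  w ∈ (b.tensorAlgebra.repr f).support ∧
    ∀ u ∈ (b.tensorAlgebra.repr f).support, u ≠ w → DegLexLT u w

/-- `r` is a Groebner basis of the two-sided ideal `I` for the degree-lexicographical order: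
`r` is a subset of `I` and the leading monomial of each nonzero element of `I` contains the leading
monomial of some element of `r` as a subword. -/
def IsGroebnerBasis (b : Module.Basis (Fin n) k V) (r : Set (TensorAlgebra k V))
    (I : TwoSidedIdeal (TensorAlgebra k V)) : Prop :=
  (∀ f ∈ r, f ∈ I) ∧
    ∀ f ∈ I, f ≠ 0 → ∃ w, IsLeadingMonomial b f w ∧
      ∃ h ∈ r, ∃ t, IsLeadingMonomial b h t ∧ ∃ p q, w = p * t * q

end Groebner

/-! ### Graded algebras and homogeneous Koszulity -/

section Koszul

variable {k A : Type*} [Field k] [Ring A] [Algebra k A]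

/-- `𝒜` is a grading of `A` that makes `A` a standard algebra: finite-dimensional components,
degree-zero component `k`, generated by the degree-one component. -/
structure IsStandard (𝒜 : ℕ → Submodule k A) : Prop where
  indep : iSupIndep 𝒜
  iSup_eq_top : ⨆ m, 𝒜 m = ⊤
  mul_mem : ∀ {i j : ℕ} {x y : A}, x ∈ 𝒜 i → y ∈ 𝒜 j → x * y ∈ 𝒜 (i + j)
  finite : ∀ m, Module.Finite k (𝒜 m)
  nontrivial : Nontrivial A
  zero_eq : 𝒜 0 = 1
  generated : Algebra.adjoin k (𝒜 1 : Set A) = ⊤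

/-- The right module `M`, graded by `ℳ`, over the algebra `A`, graded by `𝒜`, has a linear free
resolution `⋯ → F₁ → F₀ → M → 0`: here `F i = (I i → A)` is the free graded right module of finite
rank with generators in degree `d + i`, so a vector with entries in `𝒜 m` has degree `d + i + m`;
all maps are right linear and preserve degrees. -/
def HasLinearFreeResolution (𝒜 : ℕ → Submodule k A) {M : Type*} [AddCommGroup M]
    [Module Aᵐᵒᵖ M] (ℳ : ℕ → AddSubgroup M) (d : ℕ) : Prop :=
  ∃ (I : ℕ → Type) (_ : ∀ i, Finite (I i))
    (π : (I 0 → A) →ₗ[Aᵐᵒᵖ] M)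
    (δ : ∀ i, (I (i + 1) → A) →ₗ[Aᵐᵒᵖ] (I i → A)),
    (∀ (m : ℕ) (x : I 0 → A), (∀ q, x q ∈ 𝒜 m) → π x ∈ ℳ (d + m)) ∧
    (∀ (i m : ℕ) (x : I (i + 1) → A), (∀ q, x q ∈ 𝒜 m) → ∀ p, δ i x p ∈ 𝒜 (m + 1)) ∧
    Function.Surjective π ∧ Function.Exact (δ 0) π ∧ ∀ i, Function.Exact (δ (i + 1)) (δ i)

/-- The augmentation ideal `A₊` of a graded algebra, as a right ideal. -/
def augRightIdeal (𝒜 : ℕ → Submodule k A) : Submodule Aᵐᵒᵖ A :=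
  Submodule.span Aᵐᵒᵖ {x | ∃ m, 0 < m ∧ x ∈ 𝒜 m}

/-- The standard algebra `A`, graded by `𝒜`, is (homogeneous) Koszul: the trivial right module
`A / A₊`, with the grading induced from `A`, has a linear free resolution with generator in
degree `0`. -/
def IsHomogeneousKoszul (𝒜 : ℕ → Submodule k A) : Prop :=
  IsStandard 𝒜 ∧
    HasLinearFreeResolution 𝒜 (M := A ⧸ augRightIdeal 𝒜)
      (fun m => (𝒜 m).toAddSubgroup.map (augRightIdeal 𝒜).mkQ.toAddMonoidHom) 0

/-- `A` and `B`, with generating maps from `V`, are isomorphic as graded algebras, by an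
isomorphism that is the identity on `V`. -/
def GradedIso {B V : Type*} [Ring B] [Algebra k B] [AddCommGroup V] [Module k V]
    (𝒜 : ℕ → Submodule k A) (ℬ : ℕ → Submodule k B) (genA : V → A) (genB : V → B) : Prop :=
  ∃ e : A ≃ₐ[k] B, (∀ v, e (genA v) = genB v) ∧ ∀ m, (𝒜 m).map e.toLinearMap = ℬ m

end Koszul

/-! ### The associated graded algebra of an algebra with a given space of generators -/

namespace GenFilt

variable {k A : Type*} [Field k] [Ring A] [Algebra k A] (W : Submodule k A)

/-- Elements which are polynomials of degree at most `m` in elements of `W`. -/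
def le (m : ℕ) : Submodule k A := ⨆ j, ⨆ (_ : j ≤ m), W ^ j

/-- Elements which are polynomials of degree less than `m` in elements of `W`. -/
def lt (m : ℕ) : Submodule k A := ⨆ j, ⨆ (_ : j < m), W ^ j

theorem pow_le_le {j m : ℕ} (h : j ≤ m) : W ^ j ≤ le W m :=
  le_iSup₂_of_le j h le_rfl

theorem pow_le_lt {j m : ℕ} (h : j < m) : W ^ j ≤ lt W m :=
  le_iSup₂_of_le j h le_rfl

theorem le_mul_le (i j : ℕ) : le W i * le W j ≤ le W (i + j) := by
  simp only [le, Submodule.iSup_mul, Submodule.mul_iSup, iSup_le_iff]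
  intro a ha b hb
  rw [← pow_add]
  exact pow_le_le W (by omega)

theorem lt_mul_le (i j : ℕ) : lt W i * le W j ≤ lt W (i + j) := by
  simp only [le, lt, Submodule.iSup_mul, Submodule.mul_iSup, iSup_le_iff]
  intro a ha b hb
  rw [← pow_add]
  exact pow_le_lt W (by omega)

theorem le_mul_lt (i j : ℕ) : le W i * lt W j ≤ lt W (i + j) := by
  simp only [le, lt, Submodule.iSup_mul, Submodule.mul_iSup, iSup_le_iff]
  intro a ha b hb
  rw [← pow_add]
  exact pow_le_lt W (by omega)

/-- The component `F_m / F_{m-1}` of the associated graded algebra. -/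
def Comp (m : ℕ) : Type _ := le W m ⧸ (lt W m).comap (le W m).subtype

instance (m : ℕ) : AddCommGroup (Comp W m) :=
  inferInstanceAs (AddCommGroup (le W m ⧸ (lt W m).comap (le W m).subtype))

instance (m : ℕ) : Module k (Comp W m) :=
  inferInstanceAs (Module k (le W m ⧸ (lt W m).comap (le W m).subtype))

/-- The class in `F_m / F_{m-1}` of an element of `F_m`. -/
def cls (m : ℕ) : le W m →ₗ[k] Comp W m :=
  ((lt W m).comap (le W m).subtype).mkQ

theorem cls_surjective (m : ℕ) : Function.Surjective (cls W m) :=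
  Submodule.mkQ_surjective _

theorem cls_eq_zero {m : ℕ} {x : le W m} : cls W m x = 0 ↔ (x : A) ∈ lt W m :=
  Submodule.Quotient.mk_eq_zero _

/-- The product of representatives. -/
def mulRep (i j : ℕ) : le W i →ₗ[k] le W j →ₗ[k] le W (i + j) :=
  LinearMap.mk₂ k (fun x y => ⟨x * y, le_mul_le W i j (Submodule.mul_mem_mul x.2 y.2)⟩)
    (fun _ _ _ => Subtype.ext (add_mul _ _ _)) (fun _ _ _ => Subtype.ext (smul_mul_assoc _ _ _))
    (fun _ _ _ => Subtype.ext (mul_add _ _ _)) (fun _ _ _ => Subtype.ext (mul_smul_comm _ _ _))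

/-- Multiplication by a representative from the left, `F_j / F_{j-1} → F_{i+j} / F_{i+j-1}`. -/
def mulLeft (i j : ℕ) (x : le W i) : Comp W j →ₗ[k] Comp W (i + j) :=
  Submodule.liftQ _ (cls W (i + j) ∘ₗ mulRep W i j x) (fun _ hy =>
    (cls_eq_zero W).2 (le_mul_lt W i j (Submodule.mul_mem_mul x.2 hy)))

theorem mulLeft_cls (i j : ℕ) (x : le W i) (y : le W j) :
    mulLeft W i j x (cls W j y) = cls W (i + j) (mulRep W i j x y) := rfl

/-- The multiplication `F_i / F_{i-1} × F_j / F_{j-1} → F_{i+j} / F_{i+j-1}`, induced by the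
multiplication of representatives. -/
def mulCls (i j : ℕ) : Comp W i →ₗ[k] Comp W j →ₗ[k] Comp W (i + j) :=
  Submodule.liftQ _
    { toFun := mulLeft W i j
      map_add' := fun x x' => by
        ext y
        obtain ⟨y, rfl⟩ := cls_surjective W j y
        simp [mulLeft_cls]
      map_smul' := fun c x => by
        ext y
        obtain ⟨y, rfl⟩ := cls_surjective W j y
        simp [mulLeft_cls] }
    (fun x hx => by
      ext y
      obtain ⟨y, rfl⟩ := cls_surjective W j y
      exact (cls_eq_zero W).2 (lt_mul_le W i j (Submodule.mul_mem_mul hx y.2)))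

theorem mulCls_cls (i j : ℕ) (x : le W i) (y : le W j) :
    mulCls W i j (cls W i x) (cls W j y) = cls W (i + j) (mulRep W i j x y) := rfl

theorem one_mem_le (m : ℕ) : (1 : A) ∈ le W m :=
  pow_le_le W (Nat.zero_le m) (by rw [pow_zero]; exact Submodule.one_le.1 le_rfl)

theorem mk_cls_eq {i j : ℕ} (h : i = j) (x : le W i) (y : le W j) (hxy : (x : A) = y) :
    GradedMonoid.mk (A := Comp W) i (cls W i x) = GradedMonoid.mk j (cls W j y) := by
  subst h
  rw [Subtype.ext hxy]

instance : GradedMonoid.GMul (Comp W) := ⟨fun {i j} x y => mulCls W i j x y⟩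

instance : GradedMonoid.GOne (Comp W) := ⟨cls W 0 ⟨1, one_mem_le W 0⟩⟩

instance gring : DirectSum.GRing (Comp W) where
  mul_zero a := map_zero (mulCls W _ _ a)
  zero_mul b := LinearMap.map_zero₂ (mulCls W _ _) b
  mul_add a b c := map_add (mulCls W _ _ a) b c
  add_mul a b c := LinearMap.map_add₂ (mulCls W _ _) a b c
  one_mul := by
    rintro ⟨i, x⟩
    obtain ⟨x, rfl⟩ := cls_surjective W i x
    exact mk_cls_eq W (zero_add i) _ x (one_mul (x : A))
  mul_one := by
    rintro ⟨i, x⟩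
    obtain ⟨x, rfl⟩ := cls_surjective W i x
    exact mk_cls_eq W (add_zero i) _ x (mul_one (x : A))
  mul_assoc := by
    rintro ⟨i, x⟩ ⟨j, y⟩ ⟨l, z⟩
    obtain ⟨x, rfl⟩ := cls_surjective W i x
    obtain ⟨y, rfl⟩ := cls_surjective W j y
    obtain ⟨z, rfl⟩ := cls_surjective W l z
    exact mk_cls_eq W (add_assoc i j l) _ _ (mul_assoc (x : A) y z)
  natCast c := c • cls W 0 ⟨1, one_mem_le W 0⟩
  natCast_zero := zero_smul _ _
  natCast_succ c := succ_nsmul _ c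
  intCast c := c • cls W 0 ⟨1, one_mem_le W 0⟩
  intCast_ofNat c := natCast_zsmul _ c
  intCast_negSucc_ofNat c := negSucc_zsmul _ c

instance galgebra : DirectSum.GAlgebra k (Comp W) where
  toFun :=
    { toFun := fun c => c • cls W 0 ⟨1, one_mem_le W 0⟩
      map_zero' := zero_smul _ _
      map_add' := fun _ _ => add_smul _ _ _ }
  map_one := one_smul _ _
  map_mul c c' := by
    refine mk_cls_eq W (zero_add 0).symm ((c * c') • ⟨1, one_mem_le W 0⟩)
      (mulRep W 0 0 (c • ⟨1, one_mem_le W 0⟩) (c' • ⟨1, one_mem_le W 0⟩)) ?_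
    simp [mulRep, mul_smul, smul_comm c c']
  commutes c := by
    rintro ⟨i, x⟩
    obtain ⟨x, rfl⟩ := cls_surjective W i x
    refine mk_cls_eq W ((zero_add i).trans (add_zero i).symm)
      (mulRep W 0 i (c • ⟨1, one_mem_le W 0⟩) x) (mulRep W i 0 x (c • ⟨1, one_mem_le W 0⟩)) ?_
    simp [mulRep]
  smul_def c := by
    rintro ⟨i, x⟩
    obtain ⟨x, rfl⟩ := cls_surjective W i x
    refine mk_cls_eq W (zero_add i).symm (c • x) (mulRep W 0 i (c • ⟨1, one_mem_le W 0⟩) x) ?_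
    simp [mulRep]

/-- The associated graded algebra `⨁ F_m / F_{m-1}` of `A`, filtered by total degree in `W`. -/
abbrev Gr := ⨁ m, Comp W m

/-- The homogeneous components of the associated graded algebra. -/
noncomputable def grading (m : ℕ) : Submodule k (Gr W) :=
  LinearMap.range (DirectSum.lof k ℕ (Comp W) m)

/-- The class in degree one of an element of `W`. -/
noncomputable def grOf (x : W) : Gr W :=
  DirectSum.lof k ℕ (Comp W) 1
    (cls W 1 ⟨x, pow_le_le W le_rfl (by rw [pow_one]; exact x.2)⟩)

end GenFilt

/-! ### Almost quadratic algebras -/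

section AlmostQuadratic

variable {k A V : Type*} [Field k] [Ring A] [Algebra k A] [AddCommGroup V] [Module k V]

/-- The homogeneous component `V ⊗ ⋯ ⊗ V` of degree `m` of the tensor algebra. -/
abbrev tensorDeg (k V : Type*) [Field k] [AddCommGroup V] [Module k V] (m : ℕ) :
    Submodule k (TensorAlgebra k V) :=
  LinearMap.range (TensorAlgebra.ι k : V →ₗ[k] TensorAlgebra k V) ^ m

/-- `A` is an almost quadratic algebra with the finite-dimensional space of generators `V`,
embedded by `gen`, and with the space of relations `rel ⊆ V ⊕ V ⊗ V`: it is augmented, with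
augmentation ideal generated by `V`, and the canonical map `T(V) → A` is surjective with kernel
generated by `rel`. -/
structure IsAlmostQuadratic (gen : V →ₗ[k] A) (rel : Submodule k (TensorAlgebra k V)) : Prop where
  finite : Module.Finite k V
  gen_injective : Function.Injective gen
  augmented : ∃ aug : A →ₐ[k] k, TwoSidedIdeal.ker aug = TwoSidedIdeal.span (Set.range gen)
  rel_le : rel ≤ tensorDeg k V 1 ⊔ tensorDeg k V 2
  surjective : Function.Surjective (TensorAlgebra.lift k gen)
  ker_eq : TwoSidedIdeal.ker (TensorAlgebra.lift k gen) = TwoSidedIdeal.span (rel : Set _)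

/-- `f = 0` for `f` in the projection of `rel ⊆ V ⊕ V ⊗ V` on `V ⊗ V`. -/
def quadRel (rel : Submodule k (TensorAlgebra k V)) (f f' : TensorAlgebra k V) : Prop :=
  f ∈ tensorDeg k V 2 ∧ (∃ l ∈ tensorDeg k V 1, f + l ∈ rel) ∧ f' = 0

/-- The homogeneous quadratic algebra `A⁰` of an almost quadratic algebra: the quotient of `T(V)`
by the ideal generated by the projection of the relations on `V ⊗ V`. -/
abbrev QuadAlg (rel : Submodule k (TensorAlgebra k V)) := RingQuot (quadRel rel)

/-- The canonical map `V → A⁰`. -/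
noncomputable def quadGen (rel : Submodule k (TensorAlgebra k V)) : V →ₗ[k] QuadAlg rel :=
  (RingQuot.mkAlgHom k (quadRel rel)).toLinearMap ∘ₗ TensorAlgebra.ι k

/-- For an algebra generated by `V`, the image of `V ⊗ ⋯ ⊗ V` (`m` factors). -/
def genDeg (gen : V →ₗ[k] A) (m : ℕ) : Submodule k A := LinearMap.range gen ^ m

/-- The associated graded algebra `gr A` for the filtration by total degree in the generators. -/
abbrev AssocGr (gen : V →ₗ[k] A) := GenFilt.Gr (LinearMap.range gen)

/-- The grading of `gr A`. -/
noncomputable abbrev assocGrading (gen : V →ₗ[k] A) : ℕ → Submodule k (AssocGr gen) :=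
  GenFilt.grading (LinearMap.range gen)

/-- The canonical map `V → gr A`. -/
noncomputable def assocGen (gen : V →ₗ[k] A) (v : V) : AssocGr gen :=
  GenFilt.grOf (LinearMap.range gen) ⟨gen v, LinearMap.mem_range_self gen v⟩

/-- An almost quadratic algebra is PBW if for some bases `b` of `V` and `r` of the space of
relations, `r` is a Groebner basis of the ideal of relations. -/
def IsPBW (gen : V →ₗ[k] A) (rel : Submodule k (TensorAlgebra k V)) : Prop :=
  IsAlmostQuadratic gen rel ∧
    ∃ (n m : ℕ) (b : Module.Basis (Fin n) k V) (r : Module.Basis (Fin m) k rel),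
      IsGroebnerBasis b (Set.range fun i => (r i : TensorAlgebra k V))
        (TwoSidedIdeal.ker (TensorAlgebra.lift k gen))

/-- An almost quadratic algebra is (nonhomogeneous) Koszul if `A⁰` and `gr A` are isomorphic and
Koszul. -/
def IsKoszulAlmostQuadratic (gen : V →ₗ[k] A) (rel : Submodule k (TensorAlgebra k V)) : Prop :=
  IsAlmostQuadratic gen rel ∧
    GradedIso (genDeg (quadGen rel)) (assocGrading gen) (quadGen rel) (assocGen gen) ∧
    IsHomogeneousKoszul (genDeg (quadGen rel)) ∧
    IsHomogeneousKoszul (assocGrading gen)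

end AlmostQuadratic

/-! Everything rests on a diamond lemma for the straightening rules. Smaller indices are larger
letters, so the leading word of `v_i v_j - ε v_j v_i - ⟨v_i, v_j⟩` for a `Defect` pair is `v_i v_j`;
on the diagonal the relation is `2 v_i v_i - ⟨v_i, v_i⟩`. Words without a defect are normal: their
indices decrease weakly, and letters with `ε = -1` are not repeated.

Choosing one defect in each word that is not normal and rewriting it defines a linear map `N` on the
tensor algebra, by recursion on words. `confluence` shows that `N` does not depend on the choices.
Two defects in a word coincide, are disjoint or share one letter. In the disjoint case a product of
two relations is expanded in two ways. In the overlapping case one uses `hexagon`, a form of the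
color Jacobi identity: the six cubic monomials cancel, and what remains is a combination of
relations in lower degree. Repeated letters produce the factors `2` and `3`, whence the assumption
on the characteristic. So `N` projects onto the span of the normal words and kills the ideal of
relations (`exists_normalForm`). This gives the Gröbner basis, the injectivity of `g → U(g)` and the
basis of normal words of `U(g)`.

Normality depends only on `ε` and the degrees, so `U(g)` and `U(g_ab)` have bases indexed by the
same words. The quadratic parts of the relations are the relations of `g_ab`, so `U(g)^0` is
`U(g_ab)`. The generators of `gr U(g)` satisfy those relations too; the resulting surjection from
`U(g_ab)` is injective because coordinates on `U(g)` induce coordinates on `gr U(g)`.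

It remains to see that `U(g_ab)` is Koszul. With zero bracket the straightening preserves length,
and the Anick resolution is linear: its `m`-th term is free on the words of length `m` all of whose
neighbouring pairs are defects. It is built for any algebra with a `QuadraticStraightening`, by
tracking leading words. -/

/-! ### Words -/

section Words

variable {n : ℕ}

/-- The degree-lexicographical order on words, as a relation on lists. -/
abbrev WordLT (u w : List (Fin n)) : Prop := List.Shortlex (fun i j : Fin n => j < i) u w

theorem WordLT.wf : WellFounded (WordLT (n := n)) :=
  List.Shortlex.wf (wellFounded_gt)

theorem WordLT.irrefl (u : List (Fin n)) : ¬ WordLT u u := WordLT.wf.irrefl.irrefl u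

theorem WordLT.trans {u v w : List (Fin n)} (h : WordLT u v) (h' : WordLT v w) : WordLT u w := by
  unfold WordLT at *
  rw [List.shortlex_def] at *
  rcases h with h | ⟨h, hl⟩ <;> rcases h' with h' | ⟨h', hl'⟩
  · left; omega
  · left; omega
  · left; omega
  · right
    refine ⟨by omega, ?_⟩
    exact List.lex_trans (fun h h' => lt_trans h' h) hl hl'

theorem WordLT.total (u w : List (Fin n)) : WordLT u w ∨ u = w ∨ WordLT w u := by
  by_cases h : WordLT u w
  · exact .inl h
  by_cases h' : WordLT w u
  · exact .inr (.inr h')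
  · exact .inr (.inl (Std.Trichotomous.trichotomous (r := WordLT (n := n)) _ _ h h'))

theorem WordLT.length_le {u w : List (Fin n)} (h : WordLT u w) : u.length ≤ w.length := by
  unfold WordLT at h
  rw [List.shortlex_def] at h
  omega

theorem WordLT.append_left {u w : List (Fin n)} (h : WordLT u w) (p : List (Fin n)) :
    WordLT (p ++ u) (p ++ w) := List.Shortlex.append_left h p

/-- The lexicographical order alone is not stable under appending on the right, since a proper
prefix may stop being smaller; equality of lengths excludes this case. -/
theorem WordLT.append_right {u w : List (Fin n)} (h : WordLT u w) (q : List (Fin n)) :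
    WordLT (u ++ q) (w ++ q) := by
  unfold WordLT at *
  rw [List.shortlex_def] at *
  rcases h with h | ⟨h, hl⟩
  · left; simpa using h
  · right
    refine ⟨by simpa using h, ?_⟩
    induction hl with
    | nil => simp at h
    | cons _ ih => exact List.Lex.cons (ih (by simpa using h))
    | rel hr => exact List.Lex.rel hr

/-- The letter of larger index is the smaller letter, so sorting an increasing pair lowers the word.
-/
theorem WordLT.swap {i j : Fin n} (h : i < j) (p u w : List (Fin n)) (hl : u.length = w.length) :
    WordLT (p ++ j :: u) (p ++ i :: w) :=
  WordLT.append_left (List.Shortlex.of_lex (by simp [hl]) (List.Lex.rel h)) p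

/-- In a nonempty finite family, some index has the largest word. -/
theorem exists_max_word {ι : Type*} (f : ι → List (Fin n)) (hf : Function.Injective f)
    (s : Finset ι) (hs : s.Nonempty) :
    ∃ p ∈ s, ∀ q ∈ s, q ≠ p → WordLT (f q) (f p) := by
  classical
  induction hs using Finset.Nonempty.cons_induction with
  | singleton a => exact ⟨a, by simp, by simp⟩
  | cons a s ha hs ih =>
    obtain ⟨p, hp, hmax⟩ := ih
    rcases WordLT.total (f a) (f p) with h | h | h
    · refine ⟨p, by simp [hp], fun q hq hqp => ?_⟩
      rcases Finset.mem_cons.1 hq with rfl | hq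
      · exact h
      · exact hmax q hq hqp
    · exact absurd (hf h ▸ hp) ha
    · refine ⟨a, by simp, fun q hq hqa => ?_⟩
      rcases Finset.mem_cons.1 hq with rfl | hq
      · exact absurd rfl hqa
      · by_cases hqp : q = p
        · exact hqp ▸ h
        · exact (hmax q hq hqp).trans h

/-- The monomial in the elements `x i` attached to a word. -/
def mon {A : Type*} [Monoid A] (x : Fin n → A) (w : List (Fin n)) : A := (w.map x).prod

section Mon

variable {A : Type*} [Monoid A] (x : Fin n → A)

@[simp] theorem mon_nil : mon x [] = 1 := rfl

@[simp] theorem mon_cons (i : Fin n) (w : List (Fin n)) : mon x (i :: w) = x i * mon x w := by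
  simp [mon]

@[simp] theorem mon_append (u w : List (Fin n)) : mon x (u ++ w) = mon x u * mon x w := by
  simp [mon]

theorem map_mon {B F : Type*} [Monoid B] [FunLike F A B] [MonoidHomClass F A B] (f : F)
    (w : List (Fin n)) : f (mon x w) = mon (f ∘ x) w := by
  simp [mon, map_list_prod]

end Mon

/-- A word is normal if no two neighbouring letters are in the relation `D`. -/
def NormalWord (D : Fin n → Fin n → Prop) (w : List (Fin n)) : Prop :=
  w.IsChain fun i j => ¬ D i j

theorem normal_nil (D : Fin n → Fin n → Prop) : NormalWord D [] := List.isChain_nil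

theorem normal_singleton (D : Fin n → Fin n → Prop) (i : Fin n) : NormalWord D [i] :=
  List.isChain_singleton _

theorem NormalWord.tail {D : Fin n → Fin n → Prop} {i : Fin n} {w : List (Fin n)}
    (h : NormalWord D (i :: w)) : NormalWord D w := List.IsChain.tail h

theorem exists_defect_of_not_normal {D : Fin n → Fin n → Prop} {w : List (Fin n)}
    (h : ¬ NormalWord D w) : ∃ p i j q, w = p ++ i :: j :: q ∧ D i j := by
  induction w with
  | nil => exact absurd (normal_nil D) h
  | cons i w ih =>
    cases w with
    | nil => exact absurd (normal_singleton D i) h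
    | cons j w =>
      by_cases hD : D i j
      · exact ⟨[], i, j, w, rfl, hD⟩
      · obtain ⟨p, a, b, q, hw, hab⟩ := ih fun hn => h (List.isChain_cons_cons.2 ⟨hD, hn⟩)
        exact ⟨i :: p, a, b, q, by rw [hw]; rfl, hab⟩

theorem not_normal_of_defect {D : Fin n → Fin n → Prop} {p q : List (Fin n)} {i j : Fin n}
    (h : D i j) : ¬ NormalWord D (p ++ i :: j :: q) := fun hn =>
  (List.isChain_append_cons_cons.1 hn).2.1 h

/-- Powers of the span of the `x i` are spanned by monomials. -/
theorem span_range_pow {k A : Type*} [Field k] [Ring A] [Algebra k A] (x : Fin n → A) (m : ℕ) :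
    Submodule.span k (Set.range x) ^ m =
      Submodule.span k (mon x '' {w | w.length = m}) := by
  induction m with
  | zero =>
    rw [pow_zero, Submodule.one_eq_span]
    congr 1
    ext y
    simp [List.length_eq_zero_iff]
  | succ m ih =>
    rw [pow_succ', ih, Submodule.span_mul_span]
    congr 1
    ext y
    simp only [Set.mem_mul, Set.mem_range, Set.mem_image, Set.mem_ofPred_eq]
    constructor
    · rintro ⟨_, ⟨i, rfl⟩, _, ⟨w, hw, rfl⟩, rfl⟩
      exact ⟨i :: w, by simp [hw], by simp⟩
    · rintro ⟨w, hw, rfl⟩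
      obtain ⟨i, w, rfl⟩ := List.exists_cons_of_length_eq_add_one hw
      exact ⟨_, ⟨i, rfl⟩, _, ⟨w, by simpa using hw, rfl⟩, by simp⟩

end Words

/-! ### The Anick resolution of an algebra with quadratic straightening laws -/

section Anick

variable {n : ℕ}

/-- Words all of whose neighbouring letters are in the relation `D`. -/
def WordChain (D : Fin n → Fin n → Prop) (m : ℕ) : Type :=
  {c : List (Fin n) // c.length = m ∧ c.IsChain D}

namespace WordChain

variable {D : Fin n → Fin n → Prop} {m : ℕ}

noncomputable instance : DecidableEq (WordChain D m) := Classical.decEq _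

instance : Finite (WordChain D m) :=
  Set.Finite.to_subtype ((List.finite_length_eq (Fin n) m).subset fun _ h => h.1)

noncomputable instance : Fintype (WordChain D m) := Fintype.ofFinite _

/-- The empty chain. -/
def nil : WordChain D 0 := ⟨[], rfl, List.isChain_nil⟩

theorem eq_nil (c : WordChain D 0) : c = nil := Subtype.ext (List.length_eq_zero_iff.1 c.2.1)

/-- A chain without its last letter. -/
def front (c : WordChain D (m + 1)) : WordChain D m :=
  ⟨c.1.dropLast, by simp [c.2.1], c.2.2.dropLast⟩

theorem ne_nil (c : WordChain D (m + 1)) : c.1 ≠ [] := by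
  intro h
  have := c.2.1
  simp [h] at this

/-- The last letter of a chain. -/
def last (c : WordChain D (m + 1)) : Fin n := c.1.getLast c.ne_nil

theorem front_append_last (c : WordChain D (m + 1)) : c.front.1 ++ [c.last] = c.1 :=
  List.dropLast_append_getLast c.ne_nil

/-- The extension of a chain by a letter. -/
def snoc (c : WordChain D m) (i : Fin n) (h : (c.1 ++ [i]).IsChain D) : WordChain D (m + 1) :=
  ⟨c.1 ++ [i], by simp [c.2.1], h⟩

@[simp] theorem front_snoc (c : WordChain D m) (i : Fin n) (h : (c.1 ++ [i]).IsChain D) :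
    (c.snoc i h).front = c := Subtype.ext (by simp [front, snoc])

@[simp] theorem last_snoc (c : WordChain D m) (i : Fin n) (h : (c.1 ++ [i]).IsChain D) :
    (c.snoc i h).last = i := by simp [last, snoc]

theorem isChain_append_singleton (c : WordChain D (m + 1)) (i : Fin n) :
    (c.1 ++ [i]).IsChain D ↔ D c.last i := by
  rw [← front_append_last, List.append_assoc]
  simp only [List.singleton_append]
  rw [List.isChain_append_cons_cons, front_append_last]
  simp [c.2.2]

end WordChain

variable {k A : Type*} [Field k] [Ring A] [Algebra k A]

/-- The normal words form a basis of `A`, and rewriting a monomial in this basis only involves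
words of the same length that are not larger. -/
structure QuadraticStraightening (k : Type*) {A : Type*} [Field k] [Ring A] [Algebra k A]
    (x : Fin n → A) (D : Fin n → Fin n → Prop) : Prop where
  linearIndependent : LinearIndependent k fun w : {w // NormalWord D w} => mon x w.1
  span_eq_top : Submodule.span k (Set.range (mon x)) = ⊤
  straighten : ∀ w, mon x w ∈ Submodule.span k
    (mon x '' {v | NormalWord D v ∧ v.length = w.length ∧ (v = w ∨ WordLT v w)})

/-- A set of words which contains, with each word, all smaller words of the same length. -/
def LowerClosed (S : Set (List (Fin n))) : Prop :=
  ∀ u ∈ S, ∀ v : List (Fin n), v.length = u.length → WordLT v u → v ∈ S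

/-- The words of the same length which are smaller than `u`. -/
def lowerWords (u : List (Fin n)) : Set (List (Fin n)) := {v | v.length = u.length ∧ WordLT v u}

theorem lowerClosed_lowerWords (u : List (Fin n)) : LowerClosed (lowerWords u) :=
  fun _ hv _ hl hlt => ⟨hl.trans hv.1, hlt.trans hv.2⟩

namespace QuadraticStraightening

variable {x : Fin n → A} {D : Fin n → Fin n → Prop} (h : QuadraticStraightening k x D)
include h

theorem span_normal : ⊤ ≤ Submodule.span k (Set.range fun w : {w // NormalWord D w} => mon x w.1) := by
  rw [← h.span_eq_top, Submodule.span_le]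
  rintro _ ⟨w, rfl⟩
  refine Submodule.span_mono ?_ (h.straighten w)
  rintro _ ⟨v, hv, rfl⟩
  exact ⟨⟨v, hv.1⟩, rfl⟩

/-- The basis of normal words. -/
noncomputable def basis : Module.Basis {w // NormalWord D w} k A :=
  Module.Basis.mk h.linearIndependent h.span_normal

@[simp] theorem basis_apply (w : {w // NormalWord D w}) : h.basis w = mon x w.1 := by
  simp [basis]

/-- The basis of the free module on chains, formed by pairs of a chain and a normal word. -/
noncomputable def chainBasis (m : ℕ) :
    Module.Basis (Σ _ : WordChain D m, {w // NormalWord D w}) k (WordChain D m → A) :=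
  Pi.basis fun _ => h.basis

omit h in
/-- The word of a basis element. -/
def chainWord {m : ℕ} (p : Σ _ : WordChain D m, {w // NormalWord D w}) : List (Fin n) :=
  p.1.1 ++ p.2.1

omit h in
-- The chain has the fixed length `m`, so the word determines where it is cut. Basis elements can
-- therefore be compared by their words.
theorem chainWord_injective {m : ℕ} : Function.Injective (chainWord (D := D) (m := m)) := by
  rintro ⟨c, v⟩ ⟨c', v'⟩ hp
  obtain ⟨h1, h2⟩ := List.append_inj hp (c.2.1.trans c'.2.1.symm)
  obtain rfl := Subtype.ext h1
  obtain rfl := Subtype.ext h2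
  rfl

theorem chainBasis_apply {m : ℕ} (p : Σ _ : WordChain D m, {w // NormalWord D w}) :
    h.chainBasis m p = Pi.single p.1 (mon x p.2.1) := by
  rw [chainBasis, Pi.basis_apply, basis_apply]

/-- The elements of the free module on chains whose words belong to `S`. -/
noncomputable def wordSpan (m : ℕ) (S : Set (List (Fin n))) : Submodule k (WordChain D m → A) :=
  Submodule.span k (h.chainBasis m '' {p | chainWord p ∈ S})

theorem mem_wordSpan {m : ℕ} {S : Set (List (Fin n))} {z : WordChain D m → A} :
    z ∈ h.wordSpan m S ↔ ∀ p, (h.chainBasis m).repr z p ≠ 0 → chainWord p ∈ S := by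
  rw [wordSpan, Module.Basis.mem_span_image]
  simp [Set.subset_def]

theorem wordSpan_mono {m : ℕ} {S S' : Set (List (Fin n))} (hS : S ⊆ S') :
    h.wordSpan m S ≤ h.wordSpan m S' :=
  Submodule.span_mono (Set.image_mono fun _ hp => hS hp)

/-- Straightening `w` only lowers it, and prefixing `c` preserves the order. -/
theorem single_mon_mem {m : ℕ} {S : Set (List (Fin n))} (hS : LowerClosed S) (c : WordChain D m)
    (w : List (Fin n)) (hw : c.1 ++ w ∈ S) : Pi.single c (mon x w) ∈ h.wordSpan m S := by
  have := Submodule.mem_map_of_mem (f := LinearMap.single k (fun _ : WordChain D m => A) c)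
    (h.straighten w)
  rw [Submodule.map_span] at this
  refine Submodule.span_le.2 ?_ this
  rintro _ ⟨_, ⟨v, ⟨hn, hl, hv⟩, rfl⟩, rfl⟩
  refine Submodule.subset_span ⟨⟨c, ⟨v, hn⟩⟩, ?_, by simp [chainBasis_apply]⟩
  rcases hv with rfl | hv
  · exact hw
  · exact hS _ hw _ (by simp [chainWord, hl]) (hv.append_left c.1)

/-- As `w` is not normal, it does not occur in its own straightening, and the inequality becomes
strict. -/
theorem single_mon_mem_lower {m : ℕ} (c : WordChain D m)
    (w : List (Fin n)) (hw : ¬ NormalWord D w) :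
    Pi.single c (mon x w) ∈ h.wordSpan m (lowerWords (c.1 ++ w)) := by
  have := Submodule.mem_map_of_mem (f := LinearMap.single k (fun _ : WordChain D m => A) c)
    (h.straighten w)
  rw [Submodule.map_span] at this
  refine Submodule.span_le.2 ?_ this
  rintro _ ⟨_, ⟨v, ⟨hn, hl, hv⟩, rfl⟩, rfl⟩
  refine Submodule.subset_span ⟨⟨c, ⟨v, hn⟩⟩, ?_, by simp [chainBasis_apply]⟩
  rcases hv with rfl | hv
  · exact absurd hn hw
  · exact ⟨by simp [chainWord, hl], hv.append_left c.1⟩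

/-- Right multiplication by a monomial. -/
theorem wordSpan_mul_mon {m : ℕ} {S S' : Set (List (Fin n))} (hS' : LowerClosed S')
    (w : List (Fin n)) (hw : ∀ u ∈ S, u ++ w ∈ S') {z : WordChain D m → A}
    (hz : z ∈ h.wordSpan m S) : (fun c => z c * mon x w) ∈ h.wordSpan m S' := by
  refine Submodule.span_induction (p := fun z _ => (fun c => z c * mon x w) ∈ h.wordSpan m S')
    ?_ ?_ ?_ ?_ hz
  · rintro _ ⟨p, hp, rfl⟩
    convert h.single_mon_mem hS' p.1 (p.2.1 ++ w) (by
      rw [← List.append_assoc]; exact hw _ hp) using 1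
    ext c
    rw [chainBasis_apply]
    by_cases hc : c = p.1
    · subst hc; simp
    · simp [hc]
  · simp only [Pi.zero_apply, zero_mul]
    exact zero_mem _
  · intro z z' _ _ h1 h2
    simp only [Pi.add_apply, add_mul]
    exact add_mem h1 h2
  · intro a z _ h1
    simp only [Pi.smul_apply, smul_mul_assoc]
    exact Submodule.smul_mem _ a h1

end QuadraticStraightening

namespace QuadraticStraightening

variable {x : Fin n → A} {D : Fin n → Fin n → Prop}

/-- The right linear map of free modules on chains with given values on the generators. -/
noncomputable def chainMap {m : ℕ} (φ : WordChain D (m + 1) → WordChain D m → A) :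
    (WordChain D (m + 1) → A) →ₗ[Aᵐᵒᵖ] (WordChain D m → A) where
  toFun f := fun p => ∑ c, φ c p * f c
  map_add' f f' := by ext p; simp [mul_add, Finset.sum_add_distrib]
  map_smul' a f := by ext p; simp [Finset.sum_mul, mul_assoc]

/-- `chainMap` is bundled as an `Aᵐᵒᵖ`-linear map, while arguments with leading words need scalars
from `k`. -/
theorem chainMap_smul {m : ℕ} (φ : WordChain D (m + 1) → WordChain D m → A) (a : k)
    (f : WordChain D (m + 1) → A) : chainMap φ (a • f) = a • chainMap φ f := by
  ext p; simp [chainMap, Finset.smul_sum]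

theorem chainMap_single {m : ℕ} (φ : WordChain D (m + 1) → WordChain D m → A)
    (c : WordChain D (m + 1)) (a : A) : chainMap φ (Pi.single c a) = fun p => φ c p * a := by
  ext p
  simp only [chainMap, LinearMap.coe_mk, AddHom.coe_mk]
  rw [Finset.sum_eq_single c]
  · simp
  · intro b _ hb; simp [hb]
  · simp

/-- The value on each generator is the last letter of the chain, up to smaller words. -/
def IsTriangular (h : QuadraticStraightening k x D) {m : ℕ}
    (φ : WordChain D (m + 1) → WordChain D m → A) : Prop :=
  ∀ c, φ c - Pi.single c.front (x c.last) ∈ h.wordSpan m (lowerWords c.1)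

section Triangular

variable {h : QuadraticStraightening k x D} {m : ℕ}
  {φ : WordChain D (m + 1) → WordChain D m → A} (hφ : h.IsTriangular φ)
include hφ

/-- Triangularity on generators, multiplied on the right by `w`: moving the last letter of the chain
to the algebra side does not change the word, and the error stays below it. -/
theorem IsTriangular.chainMap_single_mon (c : WordChain D (m + 1)) (w : List (Fin n)) :
    chainMap φ (Pi.single c (mon x w)) - Pi.single c.front (mon x (c.last :: w)) ∈
      h.wordSpan m (lowerWords (c.1 ++ w)) := by
  convert h.wordSpan_mul_mon (lowerClosed_lowerWords (c.1 ++ w)) w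
    (fun u hu => ⟨by simp [hu.1], hu.2.append_right w⟩) (hφ c) using 1
  ext p
  rw [chainMap_single]
  by_cases hp : p = c.front
  · subst hp; simp [sub_mul]
  · simp [hp]

theorem IsTriangular.chainMap_mem {S : Set (List (Fin n))} (hS : LowerClosed S)
    {f : WordChain D (m + 1) → A} (hf : f ∈ h.wordSpan (m + 1) S) :
    chainMap φ f ∈ h.wordSpan m S := by
  refine Submodule.span_induction (p := fun z _ => chainMap φ z ∈ h.wordSpan m S) ?_ ?_ ?_ ?_ hf
  · rintro _ ⟨p, hp, rfl⟩
    rw [chainBasis_apply, ← sub_add_cancel (chainMap φ _) (Pi.single p.1.front (mon x (p.1.last :: p.2.1)))]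
    refine add_mem (h.wordSpan_mono ?_ (hφ.chainMap_single_mon _ _)) (h.single_mon_mem hS _ _ ?_)
    · exact fun v hv => hS _ hp _ hv.1 hv.2
    · rw [← List.singleton_append, ← List.append_assoc, WordChain.front_append_last]
      exact hp
  · rw [map_zero]; exact zero_mem _
  · intro z z' _ _ h1 h2
    rw [map_add]; exact add_mem h1 h2
  · intro a z _ h1
    rw [chainMap_smul]; exact Submodule.smul_mem _ a h1

end Triangular

/-- `p` is the leading basis element of `z`. -/
def IsLeading (h : QuadraticStraightening k x D) {m : ℕ} (z : WordChain D m → A)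
    (p : Σ _ : WordChain D m, {w // NormalWord D w}) : Prop :=
  (h.chainBasis m).repr z p ≠ 0 ∧
    ∀ q, (h.chainBasis m).repr z q ≠ 0 → q ≠ p → WordLT (chainWord q) (chainWord p)

section Leading

variable {h : QuadraticStraightening k x D} {m : ℕ}

theorem exists_isLeading {z : WordChain D m → A} (hz : z ≠ 0) : ∃ p, h.IsLeading z p := by
  obtain ⟨p, hp, hmax⟩ := exists_max_word chainWord chainWord_injective
    ((h.chainBasis m).repr z).support (by simpa using hz)
  exact ⟨p, by simpa using hp, fun q hq => hmax q (by simpa using hq)⟩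

theorem IsLeading.sub_mem {z : WordChain D m → A}
    {p : Σ _ : WordChain D m, {w // NormalWord D w}} (hp : h.IsLeading z p)
    {S : Set (List (Fin n))} (hz : z ∈ h.wordSpan m S) :
    z - (h.chainBasis m).repr z p • h.chainBasis m p ∈
      h.wordSpan m {v | v ∈ S ∧ WordLT v (chainWord p)} := by
  rw [mem_wordSpan]
  intro q hq
  by_cases hqp : q = p
  · subst hqp; simp at hq
  · have : (h.chainBasis m).repr z q ≠ 0 := by
      simpa [Finsupp.single_apply, Ne.symm hqp] using hq
    exact ⟨h.mem_wordSpan.1 hz q this, hp.2 q this hqp⟩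

variable {φ : WordChain D (m + 1) → WordChain D m → A} (hφ : h.IsTriangular φ)
include hφ

/-- A subspace that contains the image of a triangular map, and whose leading terms all extend to
longer chains, is contained in the image, compatibly with the order of words. -/
theorem IsTriangular.exists_preimage (K : Submodule k (WordChain D m → A))
    (hK : ∀ f, chainMap φ f ∈ K)
    (hlead : ∀ z ∈ K, ∀ p, h.IsLeading z p →
      ∃ i w, p.2.1 = i :: w ∧ (p.1.1 ++ [i]).IsChain D)
    {S : Set (List (Fin n))} (hS : LowerClosed S) {z : WordChain D m → A} (hzK : z ∈ K)
    (hz : z ∈ h.wordSpan m S) : ∃ f ∈ h.wordSpan (m + 1) S, chainMap φ f = z := by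
  by_cases hz0 : z = 0
  · exact ⟨0, zero_mem _, by rw [map_zero, hz0]⟩
  obtain ⟨p, hp⟩ := exists_isLeading (h := h) hz0
  generalize hw : chainWord p = w
  induction w using WordLT.wf.induction generalizing z p with
  | _ w ih =>
  obtain ⟨i, u, hpu, hc⟩ := hlead z hzK p hp
  obtain ⟨c, v, hv⟩ := p
  obtain rfl : v = i :: u := hpu
  set a := (h.chainBasis m).repr z ⟨c, ⟨i :: u, hv⟩⟩ with ha
  -- The word `c (i u)` is read as `(c i) u`; the image of this basis element has the same leading
  -- term, so subtracting a multiple of it lowers the leading word.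
  set q : Σ _ : WordChain D (m + 1), {w // NormalWord D w} := ⟨c.snoc i hc, ⟨u, hv.tail⟩⟩ with hq
  have hqw : chainWord q = w := by
    rw [← hw]; simp [chainWord, hq, WordChain.snoc]
  have hwS : w ∈ S := hw ▸ h.mem_wordSpan.1 hz _ hp.1
  have hqS : h.chainBasis (m + 1) q ∈ h.wordSpan (m + 1) S :=
    Submodule.subset_span ⟨q, by rw [Set.mem_ofPred_eq, hqw]; exact hwS, rfl⟩
  have hr := hφ.chainMap_single_mon (c.snoc i hc) u
  rw [WordChain.front_snoc, WordChain.last_snoc] at hr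
  have hz' : z - a • chainMap φ (h.chainBasis (m + 1) q) ∈
      h.wordSpan m {v | v ∈ S ∧ WordLT v w} := by
    have h1 := hp.sub_mem hz
    rw [← ha, hw, chainBasis_apply] at h1
    have h2 : a • (chainMap φ (Pi.single (c.snoc i hc) (mon x u)) -
        Pi.single c (mon x (i :: u))) ∈ h.wordSpan m {v | v ∈ S ∧ WordLT v w} := by
      refine Submodule.smul_mem _ a (h.wordSpan_mono ?_ hr)
      intro v hv
      have : (c.snoc i hc).1 ++ u = w := hqw
      rw [this] at hv
      exact ⟨hS w hwS v hv.1 hv.2, hv.2⟩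
    convert sub_mem h1 h2 using 1
    rw [chainBasis_apply, smul_sub]
    abel
  -- `K` contains the image, so the remainder satisfies the same hypotheses and the induction on
  -- leading words applies.
  have hzK' : z - a • chainMap φ (h.chainBasis (m + 1) q) ∈ K :=
    sub_mem hzK (Submodule.smul_mem _ a (hK _))
  obtain ⟨f, hf, hfz⟩ : ∃ f ∈ h.wordSpan (m + 1) S,
      chainMap φ f = z - a • chainMap φ (h.chainBasis (m + 1) q) := by
    by_cases h0 : z - a • chainMap φ (h.chainBasis (m + 1) q) = 0
    · exact ⟨0, zero_mem _, by rw [map_zero, h0]⟩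
    · obtain ⟨p', hp'⟩ := exists_isLeading (h := h) h0
      exact ih (chainWord p') (h.mem_wordSpan.1 hz' _ hp'.1).2 hzK'
        (h.wordSpan_mono (fun v hv => hv.1) hz') h0 p' hp' rfl
  refine ⟨f + a • h.chainBasis (m + 1) q, add_mem hf (Submodule.smul_mem _ a hqS), ?_⟩
  rw [map_add, chainMap_smul, hfz, sub_add_cancel]

/-- The leading terms of the kernel of a triangular map extend to longer chains. -/
theorem IsTriangular.leading_of_ker {z : WordChain D (m + 1) → A} (hz : chainMap φ z = 0)
    {p : Σ _ : WordChain D (m + 1), {w // NormalWord D w}} (hp : h.IsLeading z p) :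
    ∃ i w, p.2.1 = i :: w ∧ (p.1.1 ++ [i]).IsChain D := by
  by_contra hcon
  obtain ⟨c, v, hv⟩ := p
  -- If `v` does not extend the chain, returning the last letter of `c` to `v` gives a normal word,
  -- hence a basis element of the target with the same word.
  have hn : NormalWord D (c.last :: v) := by
    cases v with
    | nil => exact normal_singleton D _
    | cons j v =>
      refine List.isChain_cons_cons.2 ⟨fun hD => hcon ⟨j, v, rfl, ?_⟩, hv⟩
      exact (c.isChain_append_singleton j).2 hD
  set a := (h.chainBasis (m + 1)).repr z ⟨c, ⟨v, hv⟩⟩ with ha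
  let q : Σ _ : WordChain D m, {w // NormalWord D w} := ⟨c.front, ⟨c.last :: v, hn⟩⟩
  have hqw : chainWord q = c.1 ++ v := by
    simp only [chainWord, q]
    rw [← List.singleton_append, ← List.append_assoc, WordChain.front_append_last]
  have h1 := hφ.chainMap_mem (S := {u | u ∈ Set.univ ∧ WordLT u (c.1 ++ v)})
    (fun u hu v _ hv => ⟨trivial, hv.trans hu.2⟩)
    (hp.sub_mem (S := Set.univ) (h.mem_wordSpan.2 fun _ _ => trivial))
  have h2 := Submodule.smul_mem _ a (hφ.chainMap_single_mon c v)
  -- Since `z` maps to zero, this leading term of the image would be a combination of basis elements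
  -- with strictly smaller words.
  have h3 : a • h.chainBasis m q ∈ h.wordSpan m {u | WordLT u (c.1 ++ v)} := by
    have e : a • h.chainBasis m q = -(chainMap φ (z - a • h.chainBasis (m + 1) ⟨c, ⟨v, hv⟩⟩)) -
        a • (chainMap φ (Pi.single c (mon x v)) - Pi.single c.front (mon x (c.last :: v))) := by
      rw [map_sub, hz, chainMap_smul, chainBasis_apply, chainBasis_apply, smul_sub]
      abel
    rw [e]
    exact sub_mem (neg_mem (h.wordSpan_mono (fun v hv => hv.2) h1))
      (h.wordSpan_mono (fun v hv => hv.2) h2)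
  have := h.mem_wordSpan.1 h3 q (by simpa using hp.1)
  rw [hqw] at this
  exact WordLT.irrefl _ this

/-- A triangular map which is strict for the filtrations by words is continued to the left by
another such map. -/
theorem IsTriangular.exists_next
    (hstrict : ∀ S, LowerClosed S → ∀ f, chainMap φ f ∈ h.wordSpan m S →
      ∃ f' ∈ h.wordSpan (m + 1) S, chainMap φ f' = chainMap φ f) :
    ∃ ψ : WordChain D (m + 2) → WordChain D (m + 1) → A, h.IsTriangular ψ ∧
      Function.Exact (chainMap ψ) (chainMap φ) ∧
      ∀ S, LowerClosed S → ∀ f, chainMap ψ f ∈ h.wordSpan (m + 1) S →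
        ∃ f' ∈ h.wordSpan (m + 2) S, chainMap ψ f' = chainMap ψ f := by
  -- The last two letters of a chain form a defect, so the image of the naive generator straightens
  -- to strictly lower words. Strictness then provides a preimage that is itself lower.
  have key : ∀ c : WordChain D (m + 2), ∃ y ∈ h.wordSpan (m + 1) (lowerWords c.1),
      chainMap φ y = chainMap φ (Pi.single c.front (x c.last)) := by
    intro c
    refine hstrict _ (lowerClosed_lowerWords _) _ ?_
    have h1 := hφ.chainMap_single_mon c.front [c.last]
    rw [WordChain.front_append_last] at h1
    have hD : D c.front.last c.last := (c.front.isChain_append_singleton c.last).1 (by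
      rw [WordChain.front_append_last]
      exact c.2.2)
    have h2 := h.single_mon_mem_lower c.front.front (c.front.last :: [c.last])
      (not_normal_of_defect (p := []) hD)
    rw [← List.singleton_append, ← List.append_assoc, WordChain.front_append_last,
      WordChain.front_append_last] at h2
    have := add_mem h1 h2
    simpa using this
  choose y hy hyφ using key
  -- Subtracting the lower correction gives a cycle with the prescribed leading word.
  let ψ : WordChain D (m + 2) → WordChain D (m + 1) → A :=
    fun c => Pi.single c.front (x c.last) - y c
  have hψ : h.IsTriangular ψ := fun c => by
    simpa [ψ] using neg_mem (hy c)
  have hcomp : ∀ f, chainMap φ (chainMap ψ f) = 0 := by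
    intro f
    have hf : chainMap ψ f = ∑ c, MulOpposite.op (f c) • ψ c := by
      ext p; simp [chainMap]
    rw [hf, map_sum]
    refine Finset.sum_eq_zero fun c _ => ?_
    rw [map_smul, map_sub, hyφ, sub_self, smul_zero]
  let K : Submodule k (WordChain D (m + 1) → A) :=
    { carrier := {z | chainMap φ z = 0}
      add_mem' := fun {a b} ha hb => by
        rw [Set.mem_ofPred_eq] at *
        rw [map_add, ha, hb, add_zero]
      zero_mem' := map_zero _
      smul_mem' := fun a z hz => by
        rw [Set.mem_ofPred_eq] at *
        rw [chainMap_smul, hz, smul_zero] }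
  have lift : ∀ S, LowerClosed S → ∀ z, chainMap φ z = 0 → z ∈ h.wordSpan (m + 1) S →
      ∃ f ∈ h.wordSpan (m + 2) S, chainMap ψ f = z := fun S hS z hz hzS =>
    hψ.exists_preimage K hcomp (fun z hz p hp => hφ.leading_of_ker hz hp) hS hz hzS
  refine ⟨ψ, hψ, fun z => ⟨fun hz => ?_, ?_⟩, fun S hS f hf => lift S hS _ (hcomp f) hf⟩
  · obtain ⟨f, _, hf⟩ := lift Set.univ (fun _ _ _ _ _ => trivial) z hz
      (h.mem_wordSpan.2 fun _ _ => trivial)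
    exact ⟨f, hf⟩
  · rintro ⟨f, rfl⟩
    exact hcomp f

end Leading

end QuadraticStraightening

end Anick

/-! ### Koszulity from quadratic straightening laws -/

namespace QuadraticStraightening

variable {n : ℕ} {k A : Type*} [Field k] [Ring A] [Algebra k A]
  {x : Fin n → A} {D : Fin n → Fin n → Prop} (h : QuadraticStraightening k x D)

/-- The first map of the resolution. -/
noncomputable def firstMap (x : Fin n → A) (D : Fin n → Fin n → Prop) :
    WordChain D 1 → WordChain D 0 → A := fun c => Pi.single c.front (x c.last)

theorem isTriangular_firstMap : h.IsTriangular (firstMap x D) := fun c => by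
  simp [firstMap]

/-- The coefficient of the empty word. -/
noncomputable def constCoeff : A →ₗ[k] k := h.basis.coord ⟨[], normal_nil D⟩

/-- Straightening preserves length, so the empty word comes only from itself. -/
theorem constCoeff_mon {w : List (Fin n)} (hw : w ≠ []) : h.constCoeff (mon x w) = 0 := by
  refine Submodule.span_le (p := LinearMap.ker h.constCoeff) |>.2 ?_ (h.straighten w)
  rintro _ ⟨v, ⟨hn, hl, -⟩, rfl⟩
  rw [SetLike.mem_coe, LinearMap.mem_ker, constCoeff, ← h.basis_apply ⟨v, hn⟩,
    Module.Basis.coord_apply, Module.Basis.repr_self, Finsupp.single_apply_eq_zero]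
  intro hv
  obtain rfl := (congrArg Subtype.val hv).symm
  exact absurd (List.length_eq_zero_iff.1 hl.symm) hw

theorem ker_constCoeff :
    LinearMap.ker h.constCoeff = Submodule.span k (mon x '' {w | w ≠ []}) := by
  refine le_antisymm (fun a ha => ?_) (Submodule.span_le.2 ?_)
  · rw [← h.basis.linearCombination_repr a, Finsupp.linearCombination_apply]
    refine Submodule.sum_mem _ fun v hv => Submodule.smul_mem _ _ (Submodule.subset_span ?_)
    refine ⟨v.1, fun hv0 => ?_, (h.basis_apply v).symm⟩
    rw [Finsupp.mem_support_iff] at hv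
    obtain rfl : v = ⟨[], normal_nil D⟩ := Subtype.ext hv0
    exact hv ha
  · rintro _ ⟨w, hw, rfl⟩
    exact h.constCoeff_mon hw

theorem constCoeff_mul {a : A} (ha : h.constCoeff a = 0) (b : A) : h.constCoeff (a * b) = 0 := by
  have ha' : a ∈ Submodule.span k (mon x '' {w | w ≠ []}) := h.ker_constCoeff ▸ ha
  have hb : b ∈ Submodule.span k (Set.range (mon x)) := h.span_eq_top ▸ Submodule.mem_top
  have := Submodule.mul_mem_mul ha' hb
  rw [Submodule.span_mul_span] at this
  refine Submodule.span_le (p := LinearMap.ker h.constCoeff) |>.2 ?_ this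
  rintro _ ⟨_, ⟨v, hv, rfl⟩, _, ⟨w, rfl⟩, rfl⟩
  simp only
  rw [← mon_append]
  exact h.constCoeff_mon (by simpa using fun hv' => absurd hv' hv)

theorem mem_augRightIdeal (a : A) :
    a ∈ augRightIdeal (fun m => Submodule.span k (Set.range x) ^ m) ↔ h.constCoeff a = 0 := by
  constructor
  · intro ha
    refine Submodule.span_induction (p := fun a _ => h.constCoeff a = 0) ?_ ?_ ?_ ?_ ha
    · rintro y ⟨m, hm, hy⟩
      replace hy : y ∈ Submodule.span k (Set.range x) ^ m := hy
      rw [span_range_pow] at hy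
      refine Submodule.span_le (p := LinearMap.ker h.constCoeff) |>.2 ?_ hy
      rintro _ ⟨w, hw, rfl⟩
      refine h.constCoeff_mon ?_
      rintro rfl
      exact hm.ne hw
    · exact map_zero _
    · intro y z _ _ hy hz
      rw [map_add, hy, hz, add_zero]
    · intro b y _ hy
      exact h.constCoeff_mul hy b.unop
  · intro ha
    have ha' : a ∈ Submodule.span k (mon x '' {w | w ≠ []}) := h.ker_constCoeff ▸ ha
    refine Submodule.span_induction
      (p := fun a _ => a ∈ augRightIdeal (fun m => Submodule.span k (Set.range x) ^ m))
      ?_ ?_ ?_ ?_ ha'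
    · rintro _ ⟨w, hw, rfl⟩
      refine Submodule.subset_span ⟨w.length, List.length_pos_iff.2 hw, ?_⟩
      change _ ∈ Submodule.span k (Set.range x) ^ _
      rw [span_range_pow]
      exact Submodule.subset_span ⟨w, rfl, rfl⟩
    · exact zero_mem _
    · exact fun _ _ _ _ => add_mem
    · intro c y _ hy
      -- A scalar is central, so it acts as a right multiplication and preserves the right ideal.
      have : c • y = MulOpposite.op (algebraMap k A c) • y := by
        rw [op_smul_eq_mul, ← Algebra.commutes, Algebra.smul_def]
      rw [this]
      exact Submodule.smul_mem _ _ hy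

/-- The elements of the free module of rank one without constant term. -/
noncomputable def augKernel : Submodule k (WordChain D 0 → A) :=
  LinearMap.ker (h.constCoeff ∘ₗ LinearMap.proj WordChain.nil)

theorem mem_augKernel {z : WordChain D 0 → A} :
    z ∈ h.augKernel ↔ h.constCoeff (z WordChain.nil) = 0 := Iff.rfl

theorem chainMap_firstMap_mem (f : WordChain D 1 → A) :
    chainMap (firstMap x D) f ∈ h.augKernel := by
  rw [mem_augKernel]
  simp only [chainMap, LinearMap.coe_mk, AddHom.coe_mk]
  rw [map_sum]
  refine Finset.sum_eq_zero fun c _ => h.constCoeff_mul ?_ _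
  rw [firstMap, WordChain.eq_nil c.front, Pi.single_eq_same]
  simpa using h.constCoeff_mon (w := [c.last]) (by simp)

/-- Only the empty word has no first letter, and its coefficient is the vanishing constant term; a
single letter is always a chain. -/
theorem leading_augKernel {z : WordChain D 0 → A} (hz : z ∈ h.augKernel)
    {p : Σ _ : WordChain D 0, {w // NormalWord D w}} (hp : h.IsLeading z p) :
    ∃ i w, p.2.1 = i :: w ∧ (p.1.1 ++ [i]).IsChain D := by
  obtain ⟨c, v, hv⟩ := p
  obtain rfl := c.eq_nil
  cases v with
  | nil =>
    refine absurd ?_ hp.1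
    rw [mem_augKernel] at hz
    simpa [chainBasis, constCoeff] using hz
  | cons i v => exact ⟨i, v, rfl, List.isChain_singleton i⟩

theorem exists_preimage_firstMap {S : Set (List (Fin n))} (hS : LowerClosed S)
    {z : WordChain D 0 → A} (hzK : z ∈ h.augKernel) (hz : z ∈ h.wordSpan 0 S) :
    ∃ f ∈ h.wordSpan 1 S, chainMap (firstMap x D) f = z :=
  h.isTriangular_firstMap.exists_preimage h.augKernel h.chainMap_firstMap_mem
    (fun _ hz _ hp => h.leading_augKernel hz hp) hS hzK hz

/-- Triangular maps which are strict for the filtrations by words. -/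
def StrictTriangular (m : ℕ) : Type _ :=
  {φ : WordChain D (m + 1) → WordChain D m → A // h.IsTriangular φ ∧
    ∀ S, LowerClosed S → ∀ f, chainMap φ f ∈ h.wordSpan m S →
      ∃ f' ∈ h.wordSpan (m + 1) S, chainMap φ f' = chainMap φ f}

theorem StrictTriangular.exists_next {m : ℕ} (φ : h.StrictTriangular m) :
    ∃ ψ : h.StrictTriangular (m + 1), Function.Exact (chainMap ψ.1) (chainMap φ.1) := by
  obtain ⟨ψ, h1, h2, h3⟩ := φ.2.1.exists_next φ.2.2
  exact ⟨⟨ψ, h1, h3⟩, h2⟩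

/-- The maps of the Anick resolution. -/
noncomputable def resolution : ∀ m, h.StrictTriangular m
  | 0 => ⟨firstMap x D, h.isTriangular_firstMap, fun _ hS f hf =>
      h.exists_preimage_firstMap hS (h.chainMap_firstMap_mem f) hf⟩
  | m + 1 => (StrictTriangular.exists_next h (resolution m)).choose

theorem resolution_exact (m : ℕ) :
    Function.Exact (chainMap (h.resolution (m + 1)).1) (chainMap (h.resolution m).1) :=
  (StrictTriangular.exists_next h (h.resolution m)).choose_spec

/-- This makes the resolution linear. All words involved have length `m + 1` and begin with a chain
of length `m`, so exactly one letter is left for the coefficient. -/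
theorem IsTriangular.apply_mem {h : QuadraticStraightening k x D} {m : ℕ}
    {φ : WordChain D (m + 1) → WordChain D m → A} (hφ : h.IsTriangular φ)
    (c : WordChain D (m + 1)) (p : WordChain D m) : φ c p ∈ Submodule.span k (Set.range x) := by
  have h1 : ∀ z ∈ h.wordSpan m (lowerWords c.1), z p ∈ Submodule.span k (Set.range x) := by
    intro z hz
    refine Submodule.span_le (p := (Submodule.span k (Set.range x)).comap
      (LinearMap.proj p : (WordChain D m → A) →ₗ[k] A)) |>.2 ?_ hz
    rintro _ ⟨⟨q, v, hv⟩, hq, rfl⟩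
    rw [SetLike.mem_coe, Submodule.mem_comap, LinearMap.proj_apply, chainBasis_apply]
    by_cases hqp : p = q
    · subst hqp
      have hl : v.length = 1 := by
        have := hq.1
        simp only [chainWord, List.length_append, p.2.1, c.2.1] at this
        omega
      obtain ⟨i, rfl⟩ := List.length_eq_one_iff.1 hl
      simpa using Submodule.subset_span (Set.mem_range_self i)
    · simp [hqp]
  have h2 := h1 _ (hφ c)
  have h3 : (Pi.single c.front (x c.last) : WordChain D m → A) p ∈
      Submodule.span k (Set.range x) := by
    by_cases hp : p = c.front
    · subst hp
      simpa using Submodule.subset_span (Set.mem_range_self _)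
    · simp [hp]
  simpa using add_mem h2 h3

include h in
theorem isStandard : IsStandard fun m => Submodule.span k (Set.range x) ^ m where
  indep := by
    -- Straightening preserves length, so each component is spanned by part of the basis of normal
    -- words.
    have hspan : ∀ m, Submodule.span k (Set.range x) ^ m =
        Submodule.span k (h.basis '' {w | w.1.length = m}) := by
      intro m
      rw [span_range_pow]
      refine le_antisymm (Submodule.span_le.2 ?_) (Submodule.span_mono ?_)
      · rintro _ ⟨w, hw, rfl⟩
        refine Submodule.span_mono ?_ (h.straighten w)
        rintro _ ⟨v, hv, rfl⟩
        exact ⟨⟨v, hv.1⟩, hv.2.1.trans hw, h.basis_apply _⟩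
      · rintro _ ⟨w, hw, rfl⟩
        exact ⟨w.1, hw, (h.basis_apply w).symm⟩
    simp only [hspan]
    rw [iSupIndep_def]
    intro m
    have : (⨆ j, ⨆ (_ : j ≠ m), Submodule.span k (h.basis '' {w | w.1.length = j})) =
        Submodule.span k (h.basis '' {w | w.1.length ≠ m}) := by
      simp only [← Submodule.span_iUnion, ← Set.image_iUnion]
      congr 2
      ext w
      simp
    rw [this]
    exact h.basis.linearIndependent.disjoint_span_image
      (Set.disjoint_left.2 fun _ h1 h2 => h2 h1)
  iSup_eq_top := by
    rw [eq_top_iff, ← h.span_eq_top, Submodule.span_le]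
    rintro _ ⟨w, rfl⟩
    refine Submodule.mem_iSup_of_mem w.length ?_
    rw [span_range_pow]
    exact Submodule.subset_span ⟨w, rfl, rfl⟩
  mul_mem hx hy := by
    rw [pow_add]
    exact Submodule.mul_mem_mul hx hy
  finite m := by
    rw [span_range_pow]
    exact Module.Finite.span_of_finite k ((List.finite_length_eq (Fin n) m).image _)
  nontrivial := ⟨1, 0, by
    have := h.basis.ne_zero ⟨[], normal_nil D⟩
    simpa using this⟩
  zero_eq := pow_zero _
  generated := by
    rw [pow_one, Algebra.adjoin_span, ← Algebra.toSubmodule_eq_top, eq_top_iff, ← h.span_eq_top,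
      Submodule.span_le]
    rintro _ ⟨w, rfl⟩
    refine Subalgebra.list_prod_mem _ fun y hy => ?_
    obtain ⟨i, _, rfl⟩ := List.mem_map.1 hy
    exact Algebra.subset_adjoin (Set.mem_range_self i)

include h in
theorem isHomogeneousKoszul :
    IsHomogeneousKoszul fun m => Submodule.span k (Set.range x) ^ m := by
  refine ⟨h.isStandard, WordChain D, inferInstance,
    (Submodule.mkQ _) ∘ₗ (LinearMap.proj WordChain.nil),
    fun i => chainMap (h.resolution i).1, ?_, ?_, ?_, ?_, h.resolution_exact⟩
  · intro m f hf
    rw [zero_add]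
    exact ⟨f WordChain.nil, hf _, rfl⟩
  · intro i m f hf p
    simp only [chainMap, LinearMap.coe_mk, AddHom.coe_mk]
    refine Submodule.sum_mem _ fun c _ => ?_
    rw [pow_succ']
    exact Submodule.mul_mem_mul ((h.resolution i).2.1.apply_mem c p) (hf c)
  · exact (Submodule.mkQ_surjective _).comp fun a => ⟨fun _ => a, rfl⟩
  · intro z
    have hz : z ∈ h.augKernel ↔ ((augRightIdeal fun m => Submodule.span k (Set.range x) ^ m).mkQ ∘ₗ
        LinearMap.proj WordChain.nil) z = 0 := by
      rw [mem_augKernel, ← h.mem_augRightIdeal, LinearMap.comp_apply, LinearMap.proj_apply,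
        Submodule.mkQ_apply, Submodule.Quotient.mk_eq_zero]
    rw [← hz]
    constructor
    · intro hz
      obtain ⟨f, _, hf⟩ := h.exists_preimage_firstMap (S := Set.univ) (fun _ _ _ _ _ => trivial) hz
        (h.mem_wordSpan.2 fun _ _ => trivial)
      exact ⟨f, hf⟩
    · rintro ⟨f, rfl⟩
      exact h.chainMap_firstMap_mem f

end QuadraticStraightening

/-! ### Identities between the defining relations -/

namespace CommutationFactor

variable {k Γ : Type*} [Field k] [AddCommGroup Γ] (ε : CommutationFactor k Γ)

theorem mul_swap' (α β : Γ) : (ε α β : k) * ε β α = 1 := by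
  rw [← Units.val_mul, ε.mul_swap, Units.val_one]

theorem add_left' (α β γ : Γ) : (ε (α + β) γ : k) = ε α γ * ε β γ := by
  rw [ε.add_left, Units.val_mul]

theorem add_right' (α β γ : Γ) : (ε α (β + γ) : k) = ε α β * ε α γ := by
  rw [ε.add_right, Units.val_mul]

theorem self_eq (α : Γ) : (ε α α : k) = 1 ∨ (ε α α : k) = -1 :=
  mul_self_eq_one_iff.1 (ε.mul_swap' α α)

end CommutationFactor

namespace ColorLieAlgebra

open TensorAlgebra

variable {k Γ : Type*} [Field k] [AddCommGroup Γ] {ε : CommutationFactor k Γ}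
  {g : Type*} [AddCommGroup g] [Module k g] (L : ColorLieAlgebra ε g)

theorem commRel_mem_relations {α β : Γ} {a b : g} (ha : a ∈ L.comp α) (hb : b ∈ L.comp β) :
    L.commRel α β a b ∈ L.relations :=
  Submodule.subset_span ⟨α, β, a, ha, b, hb, rfl⟩

theorem commRel_swap {α β : Γ} {a b : g} (ha : a ∈ L.comp α) (hb : b ∈ L.comp β) :
    L.commRel β α b a = -((ε β α : k) • L.commRel α β a b) := by
  have h1 : L.bracket b a = -((ε β α : k) • L.bracket a b) := L.bracket_skew hb ha
  have h2 := ε.mul_swap' β α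
  simp only [commRel, h1, map_neg, map_smul]
  linear_combination (norm := module) (-h2) • (ι k b * ι k a)

theorem bracket_self_eq_zero (h2 : (2 : k) ≠ 0) {α : Γ} {a : g} (ha : a ∈ L.comp α)
    (hε : (ε α α : k) = 1) : L.bracket a a = 0 := by
  have h1 := L.bracket_skew ha ha
  rw [hε, one_smul] at h1
  have : (2 : k) • L.bracket a a = 0 := by
    rw [two_smul]; exact eq_neg_iff_add_eq_zero.1 h1
  exact (smul_eq_zero.1 this).resolve_left h2

theorem commRel_self_eq_zero (h2 : (2 : k) ≠ 0) {α : Γ} {a : g} (ha : a ∈ L.comp α)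
    (hε : (ε α α : k) = 1) : L.commRel α α a a = 0 := by
  simp [commRel, L.bracket_self_eq_zero h2 ha hε, hε]

/-- The Jacobi identity in derivation form; in `hexagon` it eliminates one of the three double
brackets. -/
theorem bracket_bracket {α β γ : Γ} {a b c : g} (ha : a ∈ L.comp α) (hb : b ∈ L.comp β)
    (hc : c ∈ L.comp γ) :
    L.bracket (L.bracket a b) c =
      L.bracket a (L.bracket b c) - (ε α β : k) • L.bracket b (L.bracket a c) := by
  have hJ := L.jacobi ha hb hc
  have h1 := L.bracket_skew (L.bracket_mem ha hb) hc
  have h2 := L.bracket_skew ha hc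
  have h3 := ε.mul_swap' α γ
  rw [h1, h2, ε.add_left']
  simp only [map_neg, map_smul]
  linear_combination (norm := module) (-(ε α γ : k)) • hJ + h3 • L.bracket a (L.bracket b c)

/-- The two ways of reversing a product of three homogeneous elements agree modulo relations of
lower degree. -/
theorem hexagon {α β γ : Γ} {a b c : g} (ha : a ∈ L.comp α) (hb : b ∈ L.comp β)
    (hc : c ∈ L.comp γ) :
    L.commRel α β a b * ι k c + (ε α β : k) • (ι k b * L.commRel α γ a c)
      + ((ε α β : k) * ε α γ) • (L.commRel β γ b c * ι k a)
      - ι k a * L.commRel β γ b c - (ε β γ : k) • (L.commRel α γ a c * ι k b)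
      - ((ε β γ : k) * ε α γ) • (ι k c * L.commRel α β a b) ∈ L.relations := by
  -- The cubic monomials, one for each ordering of `a`, `b`, `c`, cancel in pairs. The products of a
  -- letter and a bracket assemble into three relations, whose linear parts cancel by Jacobi.
  have key : L.commRel α β a b * ι k c + (ε α β : k) • (ι k b * L.commRel α γ a c)
      + ((ε α β : k) * ε α γ) • (L.commRel β γ b c * ι k a)
      - ι k a * L.commRel β γ b c - (ε β γ : k) • (L.commRel α γ a c * ι k b)
      - ((ε β γ : k) * ε α γ) • (ι k c * L.commRel α β a b) =
      -L.commRel (α + β) γ (L.bracket a b) c + L.commRel α (β + γ) a (L.bracket b c)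
        - (ε α β : k) • L.commRel β (α + γ) b (L.bracket a c) := by
    have h1 := ε.mul_swap' α β
    simp only [commRel, L.bracket_bracket ha hb hc, ε.add_left', ε.add_right', map_sub, map_smul,
      mul_sub, sub_mul, mul_smul_comm, smul_mul_assoc, mul_assoc]
    linear_combination (norm := module)
      (-(ε β γ : k) * h1) • (ι k (L.bracket a c) * ι k b)
  rw [key]
  exact sub_mem (add_mem
    (neg_mem (L.commRel_mem_relations (L.bracket_mem ha hb) hc))
    (L.commRel_mem_relations ha (L.bracket_mem hb hc)))
    (Submodule.smul_mem _ _ (L.commRel_mem_relations hb (L.bracket_mem ha hc)))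

end ColorLieAlgebra

/-! ### Confluence of the straightening rules -/

namespace ColorLieAlgebra

open TensorAlgebra

variable {k Γ : Type*} [Field k] [AddCommGroup Γ] {ε : CommutationFactor k Γ}
  {g : Type*} [AddCommGroup g] [Module k g] (L : ColorLieAlgebra ε g)
  {n : ℕ} (b : Module.Basis (Fin n) k g) (deg : Fin n → Γ)

/-- The pairs of letters whose product is rewritten. -/
def Defect (ε : CommutationFactor k Γ) (deg : Fin n → Γ) (i j : Fin n) : Prop :=
  i < j ∨ (i = j ∧ (ε (deg i) (deg i) : k) = -1)

/-- The generators of the tensor algebra attached to a basis. -/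
noncomputable def letter (i : Fin n) : TensorAlgebra k g := ι k (b i)

/-- The defining relation attached to a pair of basis elements. -/
noncomputable def letterRel (i j : Fin n) : TensorAlgebra k g :=
  L.commRel (deg i) (deg j) (b i) (b j)

theorem tensorAlgebra_basis_apply (w : FreeMonoid (Fin n)) :
    b.tensorAlgebra w = mon (letter b) w.toList := by
  have h1 : FreeAlgebra.basisFreeMonoid k (Fin n) w = mon (FreeAlgebra.ι k) w.toList := by
    simp [FreeAlgebra.basisFreeMonoid, FreeAlgebra.equivMonoidAlgebraFreeMonoid, mon,
      FreeMonoid.lift_apply]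
  rw [Module.Basis.tensorAlgebra, Module.Basis.map_apply, h1, AlgEquiv.toLinearEquiv_apply, map_mon]
  congr 1
  ext i
  exact equivFreeAlgebra_symm_ι b i

theorem span_mon_letter : Submodule.span k (Set.range (mon (letter b))) = ⊤ := by
  rw [← b.tensorAlgebra.span_eq]
  congr 1
  ext y
  constructor
  · rintro ⟨w, rfl⟩
    exact ⟨FreeMonoid.ofList w, tensorAlgebra_basis_apply b _⟩
  · rintro ⟨w, rfl⟩
    exact ⟨w.toList, (tensorAlgebra_basis_apply b _).symm⟩

theorem span_letter : Submodule.span k (Set.range (letter b)) = LinearMap.range (ι k : g →ₗ[k] _) := by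
  have : Set.range (letter b) = ι k '' Set.range b := by
    rw [← Set.range_comp]; rfl
  rw [this, ← Submodule.map_span, b.span_eq, Submodule.map_top]

theorem ι_mem_span_letter (v : g) : ι k v ∈ Submodule.span k (Set.range (letter b)) := by
  rw [span_letter]; exact LinearMap.mem_range_self _ _

section Homogeneous

variable {b deg} (hb : ∀ i, b i ∈ L.comp (deg i))
include hb

/-- The part of `a` along basis vectors of other degrees lies both in `L.comp α` and in the sum of
the other components, hence is zero by independence. -/
theorem comp_le_span (α : Γ) : L.comp α ≤ Submodule.span k (b '' {i | deg i = α}) := by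
  intro a ha
  have h1 : a ∈ Submodule.span k (b '' {i | deg i = α}) ⊔
      Submodule.span k (b '' {i | deg i ≠ α}) := by
    rw [← Submodule.span_union, ← Set.image_union]
    have : {i | deg i = α} ∪ {i | deg i ≠ α} = Set.univ := by
      ext i; simp [em]
    rw [this, Set.image_univ, b.span_eq]
    trivial
  obtain ⟨s, hs, t, ht, rfl⟩ := Submodule.mem_sup.1 h1
  have hs' : s ∈ L.comp α := by
    refine Submodule.span_le.2 ?_ hs
    rintro _ ⟨i, rfl, rfl⟩
    exact hb i
  have ht' : t ∈ ⨆ (γ) (_ : γ ≠ α), L.comp γ := by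
    refine Submodule.span_le.2 ?_ ht
    rintro _ ⟨i, hi, rfl⟩
    exact Submodule.mem_iSup_of_mem (deg i) (Submodule.mem_iSup_of_mem hi (hb i))
  have ht0 : t ∈ L.comp α := by simpa using sub_mem ha hs'
  rw [(Submodule.disjoint_def.1 (L.comp_indep α)) t ht0 ht', add_zero]
  exact hs

theorem relations_eq_span_letterRel :
    L.relations = Submodule.span k (Set.range fun p : Fin n × Fin n => L.letterRel b deg p.1 p.2) := by
  refine le_antisymm (Submodule.span_le.2 ?_) (Submodule.span_le.2 ?_)
  · rintro _ ⟨α, β, a, ha, c, hc, rfl⟩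
    rw [SetLike.mem_coe]
    refine Submodule.span_induction (p := fun a _ => L.commRel α β a c ∈ _) ?_ ?_ ?_ ?_
      (L.comp_le_span hb α ha)
    · rintro _ ⟨i, rfl, rfl⟩
      refine Submodule.span_induction (p := fun c _ => L.commRel _ β (b i) c ∈ _) ?_ ?_ ?_ ?_
        (L.comp_le_span hb β hc)
      · rintro _ ⟨j, rfl, rfl⟩
        exact Submodule.subset_span ⟨(i, j), rfl⟩
      · simp [commRel]
      · intro y z _ _ hy hz
        convert add_mem hy hz using 1
        simp only [commRel, map_add, mul_add, add_mul]
        module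
      · intro r y _ hy
        convert Submodule.smul_mem _ r hy using 1
        simp only [commRel, map_smul, mul_smul_comm, smul_mul_assoc]
        module
    · simp [commRel]
    · intro y z _ _ hy hz
      convert add_mem hy hz using 1
      simp only [commRel, map_add, mul_add, add_mul, LinearMap.add_apply]
      module
    · intro r y _ hy
      convert Submodule.smul_mem _ r hy using 1
      simp only [commRel, map_smul, mul_smul_comm, smul_mul_assoc, LinearMap.smul_apply]
      module
  · rintro _ ⟨⟨i, j⟩, rfl⟩
    exact L.commRel_mem_relations (hb i) (hb j)

theorem letterRel_swap (i j : Fin n) :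
    L.letterRel b deg j i = -((ε (deg j) (deg i) : k) • L.letterRel b deg i j) :=
  L.commRel_swap (hb i) (hb j)

theorem letterRel_self (h2 : (2 : k) ≠ 0) (i : Fin n) (hi : ¬ Defect ε deg i i) :
    L.letterRel b deg i i = 0 :=
  L.commRel_self_eq_zero h2 (hb i) ((ε.self_eq (deg i)).resolve_right fun h => hi (.inr ⟨rfl, h⟩))

/-- Decreasing pairs give multiples of the relations of increasing pairs, and the diagonal relations
with `ε = 1` vanish. -/
theorem relations_le_iff (h2 : (2 : k) ≠ 0) (K : Submodule k (TensorAlgebra k g)) :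
    L.relations ≤ K ↔ ∀ i j, Defect ε deg i j → L.letterRel b deg i j ∈ K := by
  rw [L.relations_eq_span_letterRel hb, Submodule.span_le]
  constructor
  · exact fun h i j _ => h ⟨(i, j), rfl⟩
  · rintro h _ ⟨⟨i, j⟩, rfl⟩
    by_cases hij : Defect ε deg i j
    · exact h i j hij
    rcases lt_trichotomy i j with hlt | rfl | hlt
    · exact absurd (.inl hlt) hij
    · simp only [L.letterRel_self hb h2 _ hij]
      exact zero_mem _
    · simp only [L.letterRel_swap hb j i]
      exact neg_mem (Submodule.smul_mem _ _ (h j i (.inl hlt)))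

variable {Y : Type*} [AddCommGroup Y] [Module k Y] (N : TensorAlgebra k g →ₗ[k] Y)

omit hb in
/-- The value of `N` on the multiple of an element by two words. -/
noncomputable def sandwich (b : Module.Basis (Fin n) k g) (N : TensorAlgebra k g →ₗ[k] Y)
    (p q : List (Fin n)) : TensorAlgebra k g →ₗ[k] Y :=
  N ∘ₗ LinearMap.mulRight k (mon (letter b) q) ∘ₗ LinearMap.mulLeft k (mon (letter b) p)

omit hb in
theorem sandwich_apply (p q : List (Fin n)) (r : TensorAlgebra k g) :
    sandwich b N p q r = N (mon (letter b) p * r * mon (letter b) q) := rfl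

omit hb in
theorem sandwich_letter_mul (p q : List (Fin n)) (i : Fin n) (r : TensorAlgebra k g) :
    sandwich b N p q (letter b i * r) = sandwich b N (p ++ [i]) q r := by
  simp [sandwich_apply, mul_assoc]

omit hb in
theorem sandwich_mul_letter (p q : List (Fin n)) (i : Fin n) (r : TensorAlgebra k g) :
    sandwich b N p q (r * letter b i) = sandwich b N p (i :: q) r := by
  simp [sandwich_apply, mul_assoc]

/-- All relations at words smaller than `w` are respected by `N`. -/
def RespectsBelow (w : List (Fin n)) : Prop :=
  ∀ p q i j, Defect ε deg i j → WordLT (p ++ i :: j :: q) w →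
    sandwich b N p q (L.letterRel b deg i j) = 0

variable {N}

/-- In smaller length the letters do not matter for the order, so the whole space of relations is
respected, not only those at particular pairs. -/
theorem RespectsBelow.of_length_lt (h2 : (2 : k) ≠ 0) {w : List (Fin n)}
    (h : L.RespectsBelow (b := b) (deg := deg) N w) {p q : List (Fin n)}
    (hl : p.length + q.length + 2 < w.length) {r : TensorAlgebra k g} (hr : r ∈ L.relations) :
    sandwich b N p q r = 0 := by
  refine (L.relations_le_iff hb h2 (LinearMap.ker (sandwich b N p q))).2 (fun i j hij => ?_) hr
  refine h p q i j hij (List.Shortlex.of_length_lt ?_)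
  simp
  omega

/-- `N` kills the right-hand side of `hexagon`, which lives in lower length. Of the six terms, the
first and the fourth are to be compared; each other one is either at a smaller word, where it
vanishes, or repeats one of these two because letters coincide. -/
theorem overlap (h2 : (2 : k) ≠ 0) (h3 : (3 : k) ≠ 0) {p q : List (Fin n)} {i j l : Fin n}
    (hij : Defect ε deg i j) (hjl : Defect ε deg j l)
    (h : L.RespectsBelow (b := b) (deg := deg) N (p ++ i :: j :: l :: q)) :
    sandwich b N p (l :: q) (L.letterRel b deg i j) = 0 ↔
      sandwich b N (p ++ [i]) q (L.letterRel b deg j l) = 0 := by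
  have hex := RespectsBelow.of_length_lt L hb h2 h (p := p) (q := q) (by simp; omega)
    (L.hexagon (hb i) (hb j) (hb l))
  have hex' : sandwich b N p (l :: q) (L.letterRel b deg i j)
      + (ε (deg i) (deg j) : k) • sandwich b N (p ++ [j]) q (L.letterRel b deg i l)
      + ((ε (deg i) (deg j) : k) * ε (deg i) (deg l)) •
        sandwich b N p (i :: q) (L.letterRel b deg j l)
      - sandwich b N (p ++ [i]) q (L.letterRel b deg j l)
      - (ε (deg j) (deg l) : k) • sandwich b N p (j :: q) (L.letterRel b deg i l)
      - ((ε (deg j) (deg l) : k) * ε (deg i) (deg l)) •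
        sandwich b N (p ++ [l]) q (L.letterRel b deg i j) = 0 := by
    rw [← hex]
    simp only [← sandwich_letter_mul, ← sandwich_mul_letter, map_add, map_sub, map_smul]
    rfl
  have e2 : ∀ y : Y, (2 : k) • y = 0 → y = 0 := fun y hy => (smul_eq_zero.1 hy).resolve_left h2
  have e3 : ∀ y : Y, (3 : k) • y = 0 → y = 0 := fun y hy => (smul_eq_zero.1 hy).resolve_left h3
  rcases hij with hij | ⟨rfl, hi⟩
  · rcases hjl with hjl | ⟨rfl, hj⟩
    · have hil := hij.trans hjl
      have t2 := h (p ++ [j]) q i l (.inl hil) (by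
        simpa using WordLT.swap hij p (i :: l :: q) (j :: l :: q) rfl)
      have t3 := h p (i :: q) j l (.inl hjl) (WordLT.swap hij p _ _ rfl)
      have t5 := h p (j :: q) i l (.inl hil) (by
        simpa using WordLT.swap hjl (p ++ [i]) (j :: q) (l :: q) rfl)
      have t6 := h (p ++ [l]) q i j (.inl hij) (by
        simpa using WordLT.swap hil p (i :: j :: q) (j :: l :: q) rfl)
      rw [t2, t3, t5, t6] at hex'
      simp only [smul_zero, add_zero, sub_zero] at hex'
      rw [sub_eq_zero.1 hex']
    -- For `i < j = l` the fifth term repeats the first one, and the identity reads `2 t₁ = t₄`.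
    · have t2 := h (p ++ [j]) q i j (.inl hij) (by
        simpa using WordLT.swap hij p (i :: j :: q) (j :: j :: q) rfl)
      have t3 := h p (i :: q) j j (.inr ⟨rfl, hj⟩) (WordLT.swap hij p _ _ rfl)
      rw [t2, t3, hj] at hex'
      simp only [smul_zero, add_zero, sub_zero, neg_smul, one_smul] at hex'
      constructor
      · intro h0
        rw [h0] at hex'
        simpa using hex'
      · intro h0
        rw [h0] at hex'
        refine e2 _ ?_
        rw [two_smul]
        simpa using hex'
  · rcases hjl with hjl | ⟨rfl, hj⟩
    -- For `i = j < l` the second term repeats the fourth one, and the identity reads `t₁ = 2 t₄`.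
    · have t3 := h p (i :: q) i l (.inl hjl) (by
        simpa using WordLT.swap hjl (p ++ [i]) (i :: q) (l :: q) rfl)
      have t6 := h (p ++ [l]) q i i (.inr ⟨rfl, hi⟩) (by
        simpa using WordLT.swap hjl p (i :: i :: q) (i :: l :: q) rfl)
      rw [t3, t6, hi] at hex'
      simp only [smul_zero, add_zero, sub_zero, neg_smul, one_smul] at hex'
      constructor
      · intro h0
        rw [h0] at hex'
        refine e2 _ ?_
        rw [two_smul, ← neg_eq_zero]
        rw [← hex']
        abel
      · intro h0
        rw [h0] at hex'
        simpa using hex'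
    -- For three equal letters all terms are `t₁` or `t₄`, and the identity reads `3 (t₁ - t₄) = 0`.
    · rw [hi] at hex'
      have : (3 : k) • (sandwich b N p (i :: q) (L.letterRel b deg i i) -
          sandwich b N (p ++ [i]) q (L.letterRel b deg i i)) = 0 := by
        rw [← hex']; module
      rw [sub_eq_zero.1 (e3 _ this)]

/-- Apply `N` to the product of the two relations in their context and expand either factor: bracket
terms have lower length and vanish, leaving the two leading words and their swapped versions. -/
theorem disjoint (h2 : (2 : k) ≠ 0) {p r q : List (Fin n)} {i j l m : Fin n}
    (hij : Defect ε deg i j) (hlm : Defect ε deg l m)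
    (h : L.RespectsBelow (b := b) (deg := deg) N (p ++ i :: j :: (r ++ l :: m :: q))) :
    sandwich b N p (r ++ l :: m :: q) (L.letterRel b deg i j) = 0 ↔
      sandwich b N (p ++ i :: j :: r) q (L.letterRel b deg l m) = 0 := by
  have e2 : ∀ y : Y, (2 : k) • y = 0 ↔ y = 0 := fun y => by simp [h2]
  have hlow1 : ∀ v : g, N (mon (letter b) p * ι k v *
      (mon (letter b) r * L.letterRel b deg l m * mon (letter b) q)) = 0 := by
    intro v
    have := ι_mem_span_letter b v
    refine Submodule.span_induction (p := fun y _ => N (mon (letter b) p * y *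
      (mon (letter b) r * L.letterRel b deg l m * mon (letter b) q)) = 0) ?_ ?_ ?_ ?_ this
    · rintro _ ⟨c, rfl⟩
      have := RespectsBelow.of_length_lt L hb h2 h (p := p ++ c :: r) (q := q)
        (by simp; omega) (L.commRel_mem_relations (hb l) (hb m))
      rw [sandwich_apply] at this
      rw [← this]
      simp [mul_assoc, letterRel]
    · simp
    · intro y z _ _ hy hz
      simp [mul_add, add_mul, hy, hz]
    · intro a y _ hy
      simp [hy]
  have hlow2 : ∀ v : g, N (mon (letter b) p * L.letterRel b deg i j * mon (letter b) r * ι k v *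
      mon (letter b) q) = 0 := by
    intro v
    have := ι_mem_span_letter b v
    refine Submodule.span_induction (p := fun y _ => N (mon (letter b) p *
      L.letterRel b deg i j * mon (letter b) r * y * mon (letter b) q) = 0) ?_ ?_ ?_ ?_ this
    · rintro _ ⟨c, rfl⟩
      have := RespectsBelow.of_length_lt L hb h2 h (p := p) (q := r ++ c :: q)
        (by simp; omega) (L.commRel_mem_relations (hb i) (hb j))
      rw [sandwich_apply] at this
      rw [← this]
      simp [mul_assoc, letterRel]
    · simp
    · intro y z _ _ hy hz
      simp [mul_add, add_mul, hy, hz]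
    · intro a y _ hy
      simp [hy]
  have key : sandwich b N p (r ++ l :: m :: q) (L.letterRel b deg i j)
      - (ε (deg l) (deg m) : k) • sandwich b N p (r ++ m :: l :: q) (L.letterRel b deg i j)
      = sandwich b N (p ++ i :: j :: r) q (L.letterRel b deg l m)
      - (ε (deg i) (deg j) : k) •
        sandwich b N (p ++ j :: i :: r) q (L.letterRel b deg l m) := by
    have a1 := hlow1 (L.bracket (b i) (b j))
    have a2 := hlow2 (L.bracket (b l) (b m))
    have e : (mon (letter b) p * L.letterRel b deg i j * mon (letter b) r *
        L.letterRel b deg l m * mon (letter b) q) = (mon (letter b) p *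
        L.letterRel b deg i j * (mon (letter b) r *
        L.letterRel b deg l m * mon (letter b) q)) := by simp only [mul_assoc]
    have e' := congrArg N e
    conv_lhs at e' => rw [show L.letterRel b deg l m = letter b l * letter b m
      - (ε (deg l) (deg m) : k) • (letter b m * letter b l) - ι k (L.bracket (b l) (b m)) from rfl]
    conv_rhs at e' => rw [show L.letterRel b deg i j = letter b i * letter b j
      - (ε (deg i) (deg j) : k) • (letter b j * letter b i) - ι k (L.bracket (b i) (b j)) from rfl]
    simp only [mul_sub, sub_mul, map_sub, a1, a2, sub_zero, mul_smul_comm, smul_mul_assoc,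
      map_smul] at e'
    simp only [sandwich_apply, mon_append, mon_cons]
    simp only [mul_assoc] at e' ⊢
    exact e'
  have two : ∀ y : Y, y - (-1 : k) • y = (2 : k) • y := fun y => by module
  -- The swapped word is smaller for `l < m`; for `l = m` it is the same word and the difference is
  -- twice the first term.
  have red1 : sandwich b N p (r ++ l :: m :: q) (L.letterRel b deg i j)
      - (ε (deg l) (deg m) : k) • sandwich b N p (r ++ m :: l :: q) (L.letterRel b deg i j) = 0 ↔
      sandwich b N p (r ++ l :: m :: q) (L.letterRel b deg i j) = 0 := by
    rcases hlm with hlm | ⟨rfl, hl⟩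
    · rw [h p (r ++ m :: l :: q) i j hij (by
        simpa using WordLT.swap hlm (p ++ i :: j :: r) (l :: q) (m :: q) rfl), smul_zero, sub_zero]
    · rw [hl, two, e2]
  have red2 : sandwich b N (p ++ i :: j :: r) q (L.letterRel b deg l m)
      - (ε (deg i) (deg j) : k) •
        sandwich b N (p ++ j :: i :: r) q (L.letterRel b deg l m) = 0 ↔
      sandwich b N (p ++ i :: j :: r) q (L.letterRel b deg l m) = 0 := by
    rcases hij with hij | ⟨rfl, hi⟩
    · rw [h (p ++ j :: i :: r) q l m hlm (by
        simpa using WordLT.swap hij p (i :: (r ++ l :: m :: q)) (j :: (r ++ l :: m :: q)) rfl),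
        smul_zero, sub_zero]
    · rw [hi, two, e2]
  rw [← red1, ← red2, key]

/-- Two occurrences of rewritable pairs in a word give the same condition. -/
theorem sandwich_eq_zero_iff (h2 : (2 : k) ≠ 0) (h3 : (3 : k) ≠ 0) {p q p' q' : List (Fin n)}
    {i j i' j' : Fin n} (hij : Defect ε deg i j) (hij' : Defect ε deg i' j')
    (hw : p ++ i :: j :: q = p' ++ i' :: j' :: q')
    (h : L.RespectsBelow (b := b) (deg := deg) N (p ++ i :: j :: q))
    (hp : p.length ≤ p'.length) :
    sandwich b N p q (L.letterRel b deg i j) = 0 ↔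
      sandwich b N p' q' (L.letterRel b deg i' j') = 0 := by
  obtain ⟨s, rfl⟩ : ∃ s, p' = p ++ s := by
    obtain ⟨s, hs⟩ := List.prefix_of_prefix_length_le (List.prefix_append p (i :: j :: q))
      (hw ▸ List.prefix_append p' (i' :: j' :: q')) hp
    exact ⟨s, hs.symm⟩
  rw [List.append_assoc, List.append_cancel_left_eq] at hw
  -- The offset between the two pairs: zero means the same pair, one an overlap, at least two
  -- disjoint pairs.
  match s, hw with
  | [], hw =>
    simp only [List.nil_append, List.cons.injEq] at hw
    obtain ⟨rfl, rfl, rfl⟩ := hw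
    rw [List.append_nil]
  | [_], hw =>
    simp only [List.cons_append, List.nil_append, List.cons.injEq] at hw
    obtain ⟨rfl, rfl, rfl⟩ := hw
    exact L.overlap hb h2 h3 hij hij' h
  | _ :: _ :: s, hw =>
    simp only [List.cons_append, List.cons.injEq] at hw
    obtain ⟨rfl, rfl, rfl⟩ := hw
    exact L.disjoint hb h2 hij hij' h

/-- If `N` respects one relation at each word that is not normal, it respects all relations. -/
theorem confluence (h2 : (2 : k) ≠ 0) (h3 : (3 : k) ≠ 0)
    (hN : ∀ w, ¬ NormalWord (Defect ε deg) w → ∃ p i j q, w = p ++ i :: j :: q ∧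
      Defect ε deg i j ∧ sandwich b N p q (L.letterRel b deg i j) = 0) (p q : List (Fin n))
    {r : TensorAlgebra k g} (hr : r ∈ L.relations) : sandwich b N p q r = 0 := by
  have main : ∀ w, ∀ p q i j, Defect ε deg i j → w = p ++ i :: j :: q →
      sandwich b N p q (L.letterRel b deg i j) = 0 := by
    intro w
    induction w using WordLT.wf.induction with
    | _ w ih =>
    intro p q i j hij hw
    have hbelow : L.RespectsBelow (b := b) (deg := deg) N w := fun p q i j hij hlt =>
      ih _ hlt p q i j hij rfl
    obtain ⟨p', i', j', q', hw', hij', h0⟩ := hN w (hw ▸ not_normal_of_defect hij)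
    rcases le_total p.length p'.length with hp | hp
    · exact (L.sandwich_eq_zero_iff hb h2 h3 hij hij' (hw.symm.trans hw') (hw ▸ hbelow) hp).2 h0
    · exact (L.sandwich_eq_zero_iff hb h2 h3 hij' hij (hw'.symm.trans hw) (hw' ▸ hbelow) hp).1 h0
  exact (L.relations_le_iff hb h2 (LinearMap.ker (sandwich b N p q))).2
    (fun i j hij => main _ p q i j hij rfl) hr

end Homogeneous

end ColorLieAlgebra

/-! ### Normal forms -/

namespace ColorLieAlgebra

open TensorAlgebra

section Recursion

variable {k g : Type*} [Field k] [AddCommGroup g] [Module k g]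
  {n : ℕ} (b : Module.Basis (Fin n) k g)

theorem repr_mon_letter (w : List (Fin n)) :
    b.tensorAlgebra.repr (mon (letter b) w) = Finsupp.single (FreeMonoid.ofList w) 1 := by
  rw [← FreeMonoid.toList_ofList w, ← tensorAlgebra_basis_apply, Module.Basis.repr_self]
  rfl

theorem mem_span_mon_letter {S : Set (List (Fin n))} {y : TensorAlgebra k g} :
    y ∈ Submodule.span k (mon (letter b) '' S) ↔
      ∀ w, b.tensorAlgebra.repr y w ≠ 0 → w.toList ∈ S := by
  have : mon (letter b) '' S = b.tensorAlgebra '' {w | w.toList ∈ S} := by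
    ext z
    constructor
    · rintro ⟨w, hw, rfl⟩
      exact ⟨FreeMonoid.ofList w, hw, tensorAlgebra_basis_apply b _⟩
    · rintro ⟨w, hw, rfl⟩
      exact ⟨w.toList, hw, (tensorAlgebra_basis_apply b _).symm⟩
  rw [this, Module.Basis.mem_span_image]
  simp [Set.subset_def]

theorem mon_letter_induction {p : TensorAlgebra k g → Prop} (y : TensorAlgebra k g)
    (hmon : ∀ w, p (mon (letter b) w)) (hadd : ∀ y z, p y → p z → p (y + z))
    (hsmul : ∀ (a : k) y, p y → p (a • y)) : p y := by
  have hy : y ∈ Submodule.span k (Set.range (mon (letter b))) :=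
    span_mon_letter b ▸ Submodule.mem_top
  refine Submodule.span_induction (p := fun y _ => p y) ?_ ?_ (fun y z _ _ => hadd y z)
    (fun a y _ => hsmul a y) hy
  · rintro _ ⟨w, rfl⟩
    exact hmon w
  · simpa using hsmul 0 _ (hmon [])

/-- Rewriting rules which replace words by combinations of smaller words define normal forms. -/
theorem exists_rewriting (P : List (Fin n) → Prop) (red : List (Fin n) → TensorAlgebra k g)
    (hred : ∀ w, ¬ P w → red w ∈ Submodule.span k (mon (letter b) '' {u | WordLT u w})) :
    ∃ N : TensorAlgebra k g →ₗ[k] TensorAlgebra k g,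
      (∀ w, P w → N (mon (letter b) w) = mon (letter b) w) ∧
      ∀ w, ¬ P w → N (mon (letter b) w) = N (red w) := by
  classical
  -- The default value `0` is never reached, because `hred` makes every word of `red w` smaller than
  -- `w`.
  let F : ∀ w : List (Fin n), (∀ u, WordLT u w → TensorAlgebra k g) → TensorAlgebra k g :=
    fun w rec => if P w then mon (letter b) w else
      (b.tensorAlgebra.repr (red w)).sum fun u c =>
        if hu : WordLT u.toList w then c • rec u.toList hu else 0
  let nf : List (Fin n) → TensorAlgebra k g := WordLT.wf.fix F
  have hnf : ∀ w, nf w = F w fun u _ => nf u := fun w => WordLT.wf.fix_eq F w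
  let N := b.tensorAlgebra.constr k fun w => nf w.toList
  have hNw : ∀ w, N (mon (letter b) w) = nf w := fun w => by
    have := b.tensorAlgebra.constr_basis k (fun w => nf w.toList) (FreeMonoid.ofList w)
    rwa [tensorAlgebra_basis_apply] at this
  refine ⟨N, fun w hw => ?_, fun w hw => ?_⟩
  · rw [hNw, hnf]
    simp only [F, if_pos hw]
  · rw [hNw, hnf]
    simp only [F, if_neg hw, N]
    rw [Module.Basis.constr_apply]
    refine Finsupp.sum_congr fun u hu => ?_
    have hlt : WordLT u.toList w :=
      (mem_span_mon_letter b).1 (hred w hw) u (Finsupp.mem_support_iff.1 hu)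
    rw [dif_pos hlt]

end Recursion

variable {k Γ : Type*} [Field k] [AddCommGroup Γ] {ε : CommutationFactor k Γ}
  {g : Type*} [AddCommGroup g] [Module k g] (L : ColorLieAlgebra ε g)
  {n : ℕ} {b : Module.Basis (Fin n) k g} {deg : Fin n → Γ}

/-- The words which occur when `w` is rewritten. -/
def rewriteWords (w : List (Fin n)) : Set (List (Fin n)) :=
  {u | WordLT u w ∧ (L.bracket = 0 → u.length = w.length)}

/-- Replacing a pair by a bracket shortens the word by one letter. With zero bracket the term is
absent, so the length condition in `rewriteWords` still holds. -/
theorem mon_mul_bracket_mul_mem (p q : List (Fin n)) (i j l m : Fin n) :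
    mon (letter b) p * ι k (L.bracket (b l) (b m)) * mon (letter b) q ∈
      Submodule.span k (mon (letter b) '' L.rewriteWords (p ++ i :: j :: q)) := by
  by_cases hL : L.bracket = 0
  · simp [hL]
  refine Submodule.span_induction (p := fun y _ => mon (letter b) p * y * mon (letter b) q ∈
    Submodule.span k (mon (letter b) '' L.rewriteWords (p ++ i :: j :: q))) ?_ ?_ ?_ ?_
    (ι_mem_span_letter b (L.bracket (b l) (b m)))
  · rintro _ ⟨c, rfl⟩
    refine Submodule.subset_span ⟨p ++ c :: q, ⟨List.Shortlex.of_length_lt (by simp), ?_⟩, ?_⟩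
    · exact fun h => absurd h hL
    · simp [mul_assoc]
  · simp
  · intro y z _ _ hy hz
    simpa [mul_add, add_mul] using add_mem hy hz
  · intro a y _ hy
    simpa using Submodule.smul_mem _ a hy

/-- Rewriting one pair of letters. -/
theorem exists_rewrite (h2 : (2 : k) ≠ 0) (p q : List (Fin n)) {i j : Fin n}
    (hij : Defect ε deg i j) : ∃ c : k, c ≠ 0 ∧ mon (letter b) (p ++ i :: j :: q) -
      c • (mon (letter b) p * L.letterRel b deg i j * mon (letter b) q) ∈
      Submodule.span k (mon (letter b) '' L.rewriteWords (p ++ i :: j :: q)) := by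
  rcases hij with hij | ⟨rfl, hi⟩
  · refine ⟨1, one_ne_zero, ?_⟩
    have h1 := L.mon_mul_bracket_mul_mem (b := b) p q i j i j
    have h3 : mon (letter b) (p ++ j :: i :: q) ∈
        Submodule.span k (mon (letter b) '' L.rewriteWords (p ++ i :: j :: q)) :=
      Submodule.subset_span ⟨p ++ j :: i :: q, ⟨WordLT.swap hij p _ _ rfl, fun _ => by simp⟩, rfl⟩
    convert add_mem (Submodule.smul_mem _ (ε (deg i) (deg j) : k) h3) h1 using 1
    simp only [letterRel, commRel, mon_append, mon_cons, letter, mul_sub, sub_mul, mul_smul_comm,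
      smul_mul_assoc, mul_assoc]
    module
  · refine ⟨2⁻¹, inv_ne_zero h2, ?_⟩
    -- The diagonal relation is `2 v v - ⟨v, v⟩`, so `v v` is rewritten as half of the bracket.
    convert Submodule.smul_mem _ (2⁻¹ : k) (L.mon_mul_bracket_mul_mem (b := b) p q i i i i) using 1
    simp only [letterRel, commRel, mon_append, mon_cons, letter, mul_sub, sub_mul, mul_smul_comm,
      smul_mul_assoc, mul_assoc, hi]
    match_scalars
    · field_simp
      ring
    · ring

/-- The normal words that may occur in the normal form of `w`. -/
def normalWords (deg : Fin n → Γ) (w : List (Fin n)) : Set (List (Fin n)) :=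
  {v | NormalWord (Defect ε deg) v ∧ (v = w ∨ WordLT v w) ∧ (L.bracket = 0 → v.length = w.length)}

theorem mul_mul_mem_span {y : TensorAlgebra k g} (hy : y ∈ L.relations) (u v : TensorAlgebra k g) :
    u * y * v ∈ TwoSidedIdeal.span (L.relations : Set (TensorAlgebra k g)) :=
  TwoSidedIdeal.mul_mem_right _ _ _ (TwoSidedIdeal.mul_mem_left _ _ _ (TwoSidedIdeal.subset_span hy))

/-- The normal form: a projection onto the span of the normal words along the ideal of
relations. -/
theorem exists_normalForm (h2 : (2 : k) ≠ 0) (h3 : (3 : k) ≠ 0)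
    (hb : ∀ i, b i ∈ L.comp (deg i)) :
    ∃ N : TensorAlgebra k g →ₗ[k] TensorAlgebra k g,
      (∀ w, NormalWord (Defect ε deg) w → N (mon (letter b) w) = mon (letter b) w) ∧
      (∀ w, N (mon (letter b) w) ∈
        Submodule.span k (mon (letter b) '' L.normalWords deg w)) ∧
      (∀ y, y - N y ∈ TwoSidedIdeal.span (L.relations : Set (TensorAlgebra k g))) ∧
      ∀ y ∈ TwoSidedIdeal.span (L.relations : Set (TensorAlgebra k g)), N y = 0 := by
  classical
  have hex : ∀ w : List (Fin n), ∃ y : TensorAlgebra k g, ¬ NormalWord (Defect ε deg) w →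
      y ∈ Submodule.span k (mon (letter b) '' L.rewriteWords w) ∧
      ∃ p i j q, w = p ++ i :: j :: q ∧ Defect ε deg i j ∧ ∃ c : k, c ≠ 0 ∧
        mon (letter b) w - y = c • (mon (letter b) p * L.letterRel b deg i j * mon (letter b) q) := by
    intro w
    by_cases hw : NormalWord (Defect ε deg) w
    · exact ⟨0, fun h => absurd hw h⟩
    · obtain ⟨p, i, j, q, rfl, hij⟩ := exists_defect_of_not_normal hw
      obtain ⟨c, hc, hmem⟩ := L.exists_rewrite h2 (b := b) p q hij
      exact ⟨_, fun _ => ⟨hmem, p, i, j, q, rfl, hij, c, hc, by rw [sub_sub_cancel]⟩⟩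
  choose red hred using hex
  obtain ⟨N, hN1, hN2⟩ := exists_rewriting b (NormalWord (Defect ε deg)) red fun w hw =>
    Submodule.span_mono (Set.image_mono fun u hu => hu.1) (hred w hw).1
  -- By construction `N` agrees on `w` and `red w`, so it kills the relation chosen at `w` up to the
  -- nonzero factor `c`; confluence extends this to all relations.
  have hconf : ∀ p q, ∀ r ∈ L.relations, sandwich b N p q r = 0 := fun p q r hr =>
    L.confluence hb h2 h3 (fun w hw => by
      obtain ⟨p, i, j, q, hw', hij, c, hc, e⟩ := (hred w hw).2
      refine ⟨p, i, j, q, hw', hij, ?_⟩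
      have := congrArg N e
      rw [map_sub, hN2 w hw, sub_self, map_smul] at this
      exact (smul_eq_zero.1 this.symm).resolve_left hc) p q hr
  refine ⟨N, hN1, fun w => ?_, fun y => ?_, fun y hy => ?_⟩
  · induction w using WordLT.wf.induction with
    | _ w ih =>
    by_cases hw : NormalWord (Defect ε deg) w
    · rw [hN1 w hw]
      exact Submodule.subset_span ⟨w, ⟨hw, .inl rfl, fun _ => rfl⟩, rfl⟩
    · rw [hN2 w hw]
      refine Submodule.span_le (p := (Submodule.span k (mon (letter b) '' L.normalWords deg w)).comap N)
        |>.2 ?_ (hred w hw).1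
      rintro _ ⟨u, hu, rfl⟩
      refine Submodule.span_mono (Set.image_mono ?_) (ih u hu.1)
      rintro v ⟨hv, hvu, hl⟩
      refine ⟨hv, .inr ?_, fun h => (hl h).trans (hu.2 h)⟩
      rcases hvu with rfl | hvu
      · exact hu.1
      · exact hvu.trans hu.1
  · let J : Submodule k (TensorAlgebra k g) :=
      { carrier := {y | y - N y ∈ TwoSidedIdeal.span (L.relations : Set (TensorAlgebra k g))}
        add_mem' := fun {y z} hy hz => by
          rw [Set.mem_ofPred_eq] at *
          rw [map_add, add_sub_add_comm]
          exact add_mem hy hz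
        zero_mem' := by
          rw [Set.mem_ofPred_eq, map_zero, sub_zero]
          exact zero_mem _
        smul_mem' := fun a y hy => by
          rw [Set.mem_ofPred_eq] at *
          rw [map_smul, ← smul_sub, Algebra.smul_def]
          exact TwoSidedIdeal.mul_mem_left _ _ _ hy }
    suffices ∀ w, mon (letter b) w ∈ J from
      mon_letter_induction b (p := (· ∈ J)) y this (fun _ _ => add_mem)
        fun a _ hy => Submodule.smul_mem _ a hy
    intro w
    induction w using WordLT.wf.induction with
    | _ w ih =>
    by_cases hw : NormalWord (Defect ε deg) w
    · change mon (letter b) w - N (mon (letter b) w) ∈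
        TwoSidedIdeal.span (L.relations : Set (TensorAlgebra k g))
      rw [hN1 w hw, sub_self]
      exact zero_mem _
    · have h1 : red w ∈ J := by
        refine Submodule.span_le.2 ?_ (hred w hw).1
        rintro _ ⟨u, hu, rfl⟩
        exact ih u hu.1
      obtain ⟨p, i, j, q, -, hij, c, hc, e⟩ := (hred w hw).2
      change mon (letter b) w - N (mon (letter b) w) ∈
        TwoSidedIdeal.span (L.relations : Set (TensorAlgebra k g))
      rw [hN2 w hw, ← sub_add_sub_cancel _ (red w)]
      refine add_mem ?_ h1
      rw [e, Algebra.smul_def]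
      exact TwoSidedIdeal.mul_mem_left _ _ _
        (L.mul_mul_mem_span (L.commRel_mem_relations (hb i) (hb j)) _ _)
  · have hgen : ∀ r ∈ L.relations, ∀ u v, N (u * r * v) = 0 := by
      intro r hr u v
      refine mon_letter_induction b (p := fun u => N (u * r * v) = 0) u (fun p => ?_) ?_ ?_
      · refine mon_letter_induction b (p := fun v => N (_ * r * v) = 0) v (fun q => ?_) ?_ ?_
        · exact hconf p q r hr
        · intro y z hy hz
          rw [mul_add, map_add, hy, hz, add_zero]
        · intro a y hy
          rw [mul_smul_comm, map_smul, hy, smul_zero]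
      · intro y z hy hz
        rw [add_mul, add_mul, map_add, hy, hz, add_zero]
      · intro a y hy
        rw [smul_mul_assoc, smul_mul_assoc, map_smul, hy, smul_zero]
    -- The largest two-sided ideal contained in the kernel of `N`.
    let I : TwoSidedIdeal (TensorAlgebra k g) := TwoSidedIdeal.mk'
      {y | ∀ u v, N (u * y * v) = 0} (by simp)
      (fun {y z} hy hz u v => by rw [mul_add, add_mul, map_add, hy, hz, add_zero])
      (fun {y} hy u v => by rw [mul_neg, neg_mul, map_neg, hy, neg_zero])
      (fun {y z} hz u v => by rw [← mul_assoc]; exact hz _ _)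
      (fun {y z} hy u v => by rw [← mul_assoc, mul_assoc _ z]; exact hy _ _)
    have hI : TwoSidedIdeal.span (L.relations : Set (TensorAlgebra k g)) ≤ I :=
      TwoSidedIdeal.span_le.2 fun r hr => (TwoSidedIdeal.mem_mk' _ _ _ _ _ _ _).2 (hgen r hr)
    have := (TwoSidedIdeal.mem_mk' _ _ _ _ _ _ _).1 (hI hy) 1 1
    simpa using this

end ColorLieAlgebra

/-! ### The universal enveloping algebra as an almost quadratic algebra -/

namespace ColorLieAlgebra

open TensorAlgebra

variable {k Γ : Type*} [Field k] [AddCommGroup Γ] {ε : CommutationFactor k Γ}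
  {g : Type*} [AddCommGroup g] [Module k g] (L : ColorLieAlgebra ε g)

theorem lift_envι : TensorAlgebra.lift k L.envι = RingQuot.mkAlgHom k L.EnvRel := by
  ext v
  simp [envι]

theorem lift_envι_surjective : Function.Surjective (TensorAlgebra.lift k L.envι) := by
  rw [lift_envι]
  exact RingQuot.mkAlgHom_surjective _ _

theorem lift_envι_commRel {α β : Γ} {a b : g} (ha : a ∈ L.comp α) (hb : b ∈ L.comp β) :
    TensorAlgebra.lift k L.envι (L.commRel α β a b) = 0 := by
  rw [lift_envι, commRel, sub_sub, map_sub, sub_eq_zero]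
  exact RingQuot.mkAlgHom_rel k (EnvRel.comm ha hb)

theorem ker_lift_envι : TwoSidedIdeal.ker (TensorAlgebra.lift k L.envι) =
    TwoSidedIdeal.span (L.relations : Set (TensorAlgebra k g)) := by
  refine le_antisymm (fun y hy => ?_) (TwoSidedIdeal.span_le.2 ?_)
  · set J := TwoSidedIdeal.span (L.relations : Set (TensorAlgebra k g)) with hJ
    have hJmem : ∀ z, z ∈ J ↔ J.ringCon.mk' z = 0 := fun z => by
      conv_lhs => rw [← TwoSidedIdeal.ker_ringCon_mk' J]
      exact TwoSidedIdeal.mem_ker _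
    -- The projection of `T(g)` onto its quotient by `J` respects the defining relations, so it
    -- factors through `U(g)`.
    have hrel : ∀ ⦃u v⦄, L.EnvRel u v → J.ringCon.mk' u = J.ringCon.mk' v := by
      rintro _ _ ⟨ha, hb⟩
      rw [← sub_eq_zero, ← map_sub, ← hJmem, ← sub_sub]
      exact TwoSidedIdeal.subset_span (L.commRel_mem_relations ha hb)
    rw [TwoSidedIdeal.mem_ker, lift_envι, ← AlgHom.coe_toRingHom, RingQuot.mkAlgHom_coe] at hy
    rw [hJmem, ← RingQuot.lift_mkRingHom_apply J.ringCon.mk' hrel, hy, map_zero]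
  · intro y hy
    have : L.relations ≤ LinearMap.ker (TensorAlgebra.lift k L.envι).toLinearMap := by
      refine Submodule.span_le.2 ?_
      rintro _ ⟨α, β, a, ha, b, hb, rfl⟩
      exact L.lift_envι_commRel ha hb
    exact (TwoSidedIdeal.mem_ker _).2 (this hy)

theorem lift_envι_eq_zero {y : TensorAlgebra k g} : TensorAlgebra.lift k L.envι y = 0 ↔
    y ∈ TwoSidedIdeal.span (L.relations : Set (TensorAlgebra k g)) := by
  rw [← ker_lift_envι, TwoSidedIdeal.mem_ker]

theorem relations_le : L.relations ≤ tensorDeg k g 1 ⊔ tensorDeg k g 2 := by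
  refine Submodule.span_le.2 ?_
  rintro _ ⟨α, β, a, ha, b, hb, rfl⟩
  have h1 : ∀ v : g, ι k v ∈ tensorDeg k g 1 := fun v => by
    rw [tensorDeg, pow_one]; exact LinearMap.mem_range_self _ v
  have h2 : ∀ u v : g, ι k u * ι k v ∈ tensorDeg k g 2 := fun u v => by
    rw [tensorDeg, pow_two]
    exact Submodule.mul_mem_mul (LinearMap.mem_range_self _ u) (LinearMap.mem_range_self _ v)
  exact sub_mem (Submodule.mem_sup_right (sub_mem (h2 a b) (Submodule.smul_mem _ _ (h2 b a))))
    (Submodule.mem_sup_left (h1 _))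

/-- The augmentation of the enveloping algebra. -/
noncomputable def augmentation : L.Env →ₐ[k] k :=
  RingQuot.liftAlgHom k ⟨TensorAlgebra.lift k 0, by
    rintro _ _ ⟨ha, hb⟩
    simp⟩

theorem augmentation_lift (y : TensorAlgebra k g) :
    L.augmentation (TensorAlgebra.lift k L.envι y) = TensorAlgebra.lift k 0 y := by
  rw [lift_envι, augmentation, RingQuot.liftAlgHom_mkAlgHom_apply]

theorem ker_augmentation :
    TwoSidedIdeal.ker L.augmentation = TwoSidedIdeal.span (Set.range L.envι) := by
  refine le_antisymm (fun y hy => ?_) (TwoSidedIdeal.span_le.2 ?_)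
  · obtain ⟨t, rfl⟩ := L.lift_envι_surjective y
    rw [TwoSidedIdeal.mem_ker, augmentation_lift] at hy
    -- Every element is congruent to its constant term modulo the ideal generated by `g`.
    have key : ∀ t, TensorAlgebra.lift k L.envι t -
        algebraMap k L.Env (TensorAlgebra.lift k (0 : g →ₗ[k] k) t) ∈
          TwoSidedIdeal.span (Set.range L.envι) := by
      intro t
      induction t using TensorAlgebra.induction with
      | algebraMap r =>
        rw [AlgHom.commutes, AlgHom.commutes, Algebra.algebraMap_self_apply, sub_self]
        exact zero_mem _
      | ι v =>
        rw [TensorAlgebra.lift_ι_apply, TensorAlgebra.lift_ι_apply, LinearMap.zero_apply, map_zero,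
          sub_zero]
        exact TwoSidedIdeal.subset_span (Set.mem_range_self v)
      | mul s t hs ht =>
        rw [map_mul, map_mul, map_mul, ← sub_add_sub_cancel _
          (algebraMap k L.Env (TensorAlgebra.lift k (0 : g →ₗ[k] k) s) *
            TensorAlgebra.lift k L.envι t), ← sub_mul, ← mul_sub]
        exact add_mem (TwoSidedIdeal.mul_mem_right _ _ _ hs) (TwoSidedIdeal.mul_mem_left _ _ _ ht)
      | add s t hs ht =>
        rw [map_add, map_add, map_add, add_sub_add_comm]
        exact add_mem hs ht
    simpa [hy] using key t
  · rintro _ ⟨v, rfl⟩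
    rw [SetLike.mem_coe, TwoSidedIdeal.mem_ker]
    have := L.augmentation_lift (ι k v)
    simpa using this

theorem exists_homogeneous_basis [FiniteDimensional k g] :
    ∃ (n : ℕ) (b : Module.Basis (Fin n) k g) (deg : Fin n → Γ), ∀ i, b i ∈ L.comp (deg i) := by
  have hs : ⊤ ≤ Submodule.span k (⋃ γ, (L.comp γ : Set g)) := by
    rw [← L.comp_iSup, Submodule.iSup_eq_span]
  have hmem : ∀ i, ∃ γ, Module.Basis.ofSpan hs i ∈ L.comp γ := fun i => by
    simpa only [Set.mem_iUnion, SetLike.mem_coe] using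
      Module.Basis.ofSpan_subset hs (Set.mem_range_self i)
  generalize Module.Basis.ofSpan hs = b at hmem
  have hfin := Module.Finite.finite_basis b
  obtain ⟨n, ⟨e⟩⟩ := @Finite.exists_equiv_fin _ hfin
  choose d hd using hmem
  exact ⟨n, b.reindex e, d ∘ e.symm, fun i => by simpa using hd (e.symm i)⟩

/-! ### Leading words of the relations and the Gröbner basis -/

section Groebner

variable {n : ℕ} {b : Module.Basis (Fin n) k g} {deg : Fin n → Γ}

theorem repr_ι (v : g) (w : FreeMonoid (Fin n)) (hw : w.toList.length ≠ 1) :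
    b.tensorAlgebra.repr (ι k v) w = 0 := by
  by_contra h
  have h1 : ι k v ∈ Submodule.span k (mon (letter b) '' {w | w.length = 1}) := by
    rw [← span_range_pow, pow_one]
    exact ι_mem_span_letter b v
  exact hw ((mem_span_mon_letter b).1 h1 w h)

open Classical in
theorem repr_letterRel (i j : Fin n) (w : FreeMonoid (Fin n)) (hw : w.toList.length ≠ 1) :
    b.tensorAlgebra.repr (L.letterRel b deg i j) w =
      (if w.toList = [i, j] then 1 else 0) -
        (ε (deg i) (deg j) : k) * (if w.toList = [j, i] then 1 else 0) := by
  have h1 : ∀ i j : Fin n, ι k (b i) * ι k (b j) = mon (letter b) [i, j] := fun i j => by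
    simp [letter]
  have h2 : ∀ u : List (Fin n), (Finsupp.single (FreeMonoid.ofList u) (1 : k)) w =
      if w.toList = u then 1 else 0 := fun u => by
    rw [Finsupp.single_apply]
    congr 1
    exact propext eq_comm
  rw [letterRel, commRel, h1, h1, map_sub, map_sub, map_smul, repr_mon_letter, repr_mon_letter,
    Finsupp.sub_apply, Finsupp.sub_apply, Finsupp.smul_apply, repr_ι _ _ hw, sub_zero, h2, h2,
    smul_eq_mul]

theorem repr_letterRel_self (h2 : (2 : k) ≠ 0) {i j : Fin n} (hij : Defect ε deg i j) :
    b.tensorAlgebra.repr (L.letterRel b deg i j) (FreeMonoid.ofList [i, j]) ≠ 0 := by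
  rw [repr_letterRel _ _ _ _ (by simp)]
  rcases hij with hij | ⟨rfl, hi⟩
  · simp [hij.ne]
  · simp [hi]
    rw [one_add_one_eq_two]
    exact h2

/-- The quadratic words of a relation are `[i, j]` and `[j, i]` with `i ≤ j`, and the latter is
weakly increasing only on the diagonal. Hence no leading word occurs in another relation, which
gives linear independence. -/
theorem repr_letterRel_of_ne {i j i' j' : Fin n} (hij : Defect ε deg i j)
    (hij' : Defect ε deg i' j') (hne : ¬ (i = i' ∧ j = j')) :
    b.tensorAlgebra.repr (L.letterRel b deg i j) (FreeMonoid.ofList [i', j']) = 0 := by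
  have h1 : i ≤ j := hij.elim le_of_lt fun h => h.1.le
  have h2 : i' ≤ j' := hij'.elim le_of_lt fun h => h.1.le
  rw [repr_letterRel _ _ _ _ (by simp)]
  have e1 : ¬ (i' = i ∧ j' = j) := by rintro ⟨rfl, rfl⟩; exact hne ⟨rfl, rfl⟩
  have e2 : ¬ (i' = j ∧ j' = i) := by
    rintro ⟨rfl, rfl⟩
    obtain rfl := le_antisymm h1 h2
    exact hne ⟨rfl, rfl⟩
  simp [e1, e2]

theorem isLeadingMonomial_letterRel (h2 : (2 : k) ≠ 0) {i j : Fin n} (hij : Defect ε deg i j) :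
    IsLeadingMonomial b (L.letterRel b deg i j) (FreeMonoid.ofList [i, j]) := by
  refine ⟨Finsupp.mem_support_iff.2 (L.repr_letterRel_self h2 hij), fun u hu hne => ?_⟩
  rw [Finsupp.mem_support_iff] at hu
  by_cases hl : u.toList.length = 1
  · exact List.Shortlex.of_length_lt (by simp [hl])
  · rw [repr_letterRel _ _ _ _ hl] at hu
    have h1 : ¬ u.toList = [i, j] := fun h => hne (by rw [← h]; rfl)
    have h3 : u.toList = [j, i] := by
      by_contra h3
      simp [h1, h3] at hu
    rcases hij with hij | ⟨rfl, hi⟩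
    · have := WordLT.swap hij [] [i] [j] rfl
      rw [DegLexLT, h3]
      exact this
    · exact absurd h3 h1

theorem basisRel_eq (p : RelIndex ε deg) :
    L.basisRel b deg p = L.letterRel b deg p.1.1 p.1.2 := rfl

theorem linearIndependent_basisRel (h2 : (2 : k) ≠ 0) :
    LinearIndependent k (L.basisRel b deg) := by
  rw [linearIndependent_iff']
  intro s c hc p hp
  have h1 := congrArg (fun y => b.tensorAlgebra.repr y (FreeMonoid.ofList [p.1.1, p.1.2])) hc
  simp only [map_sum, map_smul, Finsupp.coe_finsetSum, Finset.sum_apply, Finsupp.smul_apply,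
    map_zero, Finsupp.zero_apply] at h1
  rw [Finset.sum_eq_single p] at h1
  · rw [smul_eq_mul] at h1
    exact (mul_eq_zero.1 h1).resolve_right (L.repr_letterRel_self h2 p.2)
  · intro q _ hqp
    rw [basisRel_eq, L.repr_letterRel_of_ne q.2 p.2, smul_zero]
    rintro ⟨e1, e2⟩
    exact hqp (Subtype.ext (Prod.ext e1 e2))
  · exact fun h => absurd hp h

variable (hb : ∀ i, b i ∈ L.comp (deg i))
include hb

theorem span_basisRel (h2 : (2 : k) ≠ 0) :
    Submodule.span k (Set.range (L.basisRel b deg)) = L.relations := by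
  refine le_antisymm (Submodule.span_le.2 ?_) ?_
  · rintro _ ⟨p, rfl⟩
    exact L.commRel_mem_relations (hb _) (hb _)
  · rw [L.relations_le_iff hb h2]
    exact fun i j hij => Submodule.subset_span ⟨⟨(i, j), hij⟩, rfl⟩

theorem isGroebnerBasis (h2 : (2 : k) ≠ 0) (h3 : (3 : k) ≠ 0) :
    IsGroebnerBasis b (Set.range (L.basisRel b deg))
      (TwoSidedIdeal.ker (TensorAlgebra.lift k L.envι)) := by
  obtain ⟨N, hN1, hN2, -, hN4⟩ := L.exists_normalForm h2 h3 hb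
  rw [ker_lift_envι]
  refine ⟨?_, fun f hf hf0 => ?_⟩
  · rintro _ ⟨p, rfl⟩
    exact TwoSidedIdeal.subset_span (L.commRel_mem_relations (hb _) (hb _))
  obtain ⟨w, hw, hmax⟩ := exists_max_word (fun w : FreeMonoid (Fin n) => w.toList)
    FreeMonoid.toList.injective (b.tensorAlgebra.repr f).support (by simpa using hf0)
  refine ⟨w, ⟨hw, hmax⟩, ?_⟩
  -- All other words of `f` are smaller, and so are their normal forms. If `w` were normal, its
  -- coefficient would survive in `N f`, which is zero.
  have hwn : ¬ NormalWord (Defect ε deg) w.toList := by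
    intro hwn
    have h0 : b.tensorAlgebra.repr (N f) w = 0 := by rw [hN4 f hf]; simp
    rw [← b.tensorAlgebra.linearCombination_repr f, Finsupp.linearCombination_apply,
      Finsupp.sum, map_sum, map_sum, Finsupp.coe_finsetSum, Finset.sum_apply,
      Finset.sum_eq_single w] at h0
    · rw [map_smul, map_smul, tensorAlgebra_basis_apply, hN1 _ hwn, repr_mon_letter] at h0
      simp at h0
      exact Finsupp.mem_support_iff.1 hw h0
    · intro u hu huw
      rw [map_smul, map_smul, tensorAlgebra_basis_apply, Finsupp.smul_apply, smul_eq_zero]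
      right
      by_contra hne
      have hlt : WordLT u.toList w.toList := hmax u hu huw
      rcases ((mem_span_mon_letter b).1 (hN2 u.toList) w hne).2.1 with h | h
      · exact huw (FreeMonoid.toList.injective h.symm)
      · exact WordLT.irrefl _ (h.trans hlt)
    · exact fun h => absurd hw h
  obtain ⟨p, i, j, q, hw', hij⟩ := exists_defect_of_not_normal hwn
  refine ⟨_, ⟨⟨(i, j), hij⟩, rfl⟩, _, L.isLeadingMonomial_letterRel h2 hij,
    FreeMonoid.ofList p, FreeMonoid.ofList q, ?_⟩
  apply FreeMonoid.toList.injective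
  rw [hw']
  simp

end Groebner

/-! ### Generators, relations and the PBW property -/

section Main

variable [FiniteDimensional k g] (h2 : (2 : k) ≠ 0) (h3 : (3 : k) ≠ 0)
include h2 h3

/-- Single letters are normal, so `N` fixes `g`, while it kills the ideal of relations. -/
theorem envι_injective : Function.Injective L.envι := by
  obtain ⟨n, b, deg, hb⟩ := L.exists_homogeneous_basis
  obtain ⟨N, hN1, -, -, hN4⟩ := L.exists_normalForm h2 h3 hb
  rw [injective_iff_map_eq_zero]
  intro v hv
  have h1 : ι k v ∈ TwoSidedIdeal.span (L.relations : Set (TensorAlgebra k g)) := by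
    rw [← lift_envι_eq_zero, TensorAlgebra.lift_ι_apply, hv]
  have h4 : N (ι k v) = ι k v := by
    refine Submodule.span_induction (p := fun y _ => N y = y) ?_ (map_zero _) ?_ ?_
      (ι_mem_span_letter b v)
    · rintro _ ⟨i, rfl⟩
      simpa using hN1 [i] (normal_singleton _ i)
    · intro y z _ _ hy hz
      rw [map_add, hy, hz]
    · intro a y _ hy
      rw [map_smul, hy]
  rw [hN4 _ h1] at h4
  exact (TensorAlgebra.ι_eq_zero_iff k v).1 h4.symm

theorem isAlmostQuadratic : IsAlmostQuadratic L.envι L.relations where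
  finite := inferInstance
  gen_injective := L.envι_injective h2 h3
  augmented := ⟨L.augmentation, L.ker_augmentation⟩
  rel_le := L.relations_le
  surjective := L.lift_envι_surjective
  ker_eq := L.ker_lift_envι

theorem isPBW : IsPBW L.envι L.relations := by
  classical
  obtain ⟨n, b, deg, hb⟩ := L.exists_homogeneous_basis
  have := Fintype.ofFinite (RelIndex ε deg)
  let e := Fintype.equivFin (RelIndex ε deg)
  let r := ((Module.Basis.span (L.linearIndependent_basisRel (b := b) (deg := deg) h2)).map
    (LinearEquiv.ofEq _ _ (L.span_basisRel hb h2))).reindex e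
  have hr : ∀ i, (r i : TensorAlgebra k g) = L.basisRel b deg (e.symm i) := fun i => by
    simp [r, Module.Basis.span_apply]
  refine ⟨L.isAlmostQuadratic h2 h3, n, _, b, r, ?_⟩
  convert L.isGroebnerBasis hb h2 h3 using 1
  ext y
  constructor
  · rintro ⟨i, rfl⟩
    exact ⟨e.symm i, (hr i).symm⟩
  · rintro ⟨p, rfl⟩
    exact ⟨e p, by simp [hr]⟩

end Main

end ColorLieAlgebra

/-! ### Graded isomorphisms -/

section GradedIso

variable {k A B C V : Type*} [Field k] [Ring A] [Algebra k A] [Ring B] [Algebra k B]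
  [Ring C] [Algebra k C] [AddCommGroup V] [Module k V]
  {𝒜 : ℕ → Submodule k A} {ℬ : ℕ → Submodule k B} {𝒞 : ℕ → Submodule k C}
  {genA : V → A} {genB : V → B} {genC : V → C}

theorem GradedIso.symm (h : GradedIso 𝒜 ℬ genA genB) : GradedIso ℬ 𝒜 genB genA := by
  obtain ⟨e, he, hm⟩ := h
  refine ⟨e.symm, fun v => by rw [← he, e.symm_apply_apply], fun m => ?_⟩
  rw [← hm, ← Submodule.map_comp]
  convert Submodule.map_id _
  ext y
  simp

theorem GradedIso.trans (h : GradedIso 𝒜 ℬ genA genB) (h' : GradedIso ℬ 𝒞 genB genC) :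
    GradedIso 𝒜 𝒞 genA genC := by
  obtain ⟨e, he, hm⟩ := h
  obtain ⟨e', he', hm'⟩ := h'
  refine ⟨e.trans e', fun v => by simp [he, he'], fun m => ?_⟩
  rw [← hm', ← hm, ← Submodule.map_comp]
  rfl

/-- The powers of the space of generators are spanned by the monomials in a basis. -/
theorem genDeg_eq_span_pow {n : ℕ} (b : Module.Basis (Fin n) k V) (gen : V →ₗ[k] A) (m : ℕ) :
    genDeg gen m = Submodule.span k (Set.range (gen ∘ b)) ^ m := by
  rw [genDeg, Set.range_comp, ← Submodule.map_span, b.span_eq, Submodule.map_top]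

theorem map_span_range_pow {n : ℕ} (f : A →ₐ[k] B) (x : Fin n → A) (m : ℕ) :
    (Submodule.span k (Set.range x) ^ m).map f.toLinearMap =
      Submodule.span k (Set.range (f ∘ x)) ^ m := by
  rw [Submodule.map_pow, Submodule.map_span, Set.range_comp]
  rfl

theorem QuadraticStraightening.map {n : ℕ} {x : Fin n → A} {D : Fin n → Fin n → Prop}
    (h : QuadraticStraightening k x D) (e : A ≃ₐ[k] B) : QuadraticStraightening k (e ∘ x) D := by
  have hmon : ∀ w, mon (e ∘ x) w = e.toLinearMap (mon x w) := fun w => (map_mon x e w).symm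
  have himg : ∀ S, mon (e ∘ x) '' S = e.toLinearMap '' (mon x '' S) := fun S => by
    rw [Set.image_image]
    exact Set.image_congr fun w _ => hmon w
  refine ⟨?_, ?_, fun w => ?_⟩
  · simp only [hmon]
    exact h.linearIndependent.map' e.toLinearMap (LinearMap.ker_eq_bot.2 e.injective)
  · rw [← Set.image_univ, himg, ← Submodule.map_span, Set.image_univ, h.span_eq_top,
      Submodule.map_top, LinearMap.range_eq_top]
    exact e.surjective
  · rw [hmon, himg, ← Submodule.map_span]
    exact Submodule.mem_map_of_mem (h.straighten w)

end GradedIso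

/-! ### Monomials in associated graded algebras -/

namespace GenFilt

variable {k A : Type*} [Field k] [Ring A] [Algebra k A] (W : Submodule k A)

theorem lof_cls_congr {i j : ℕ} (h : i = j) (y : le W i) (z : le W j) (hyz : (y : A) = z) :
    DirectSum.lof k ℕ (Comp W) i (cls W i y) = DirectSum.lof k ℕ (Comp W) j (cls W j z) := by
  subst h
  rw [Subtype.ext hyz]

theorem lof_cls_mul_lof_cls {i j : ℕ} (y : le W i) (z : le W j) :
    DirectSum.lof k ℕ (Comp W) i (cls W i y) * DirectSum.lof k ℕ (Comp W) j (cls W j z) =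
      DirectSum.lof k ℕ (Comp W) (i + j) (cls W (i + j) (mulRep W i j y z)) := by
  simp only [DirectSum.lof_eq_of]
  rw [DirectSum.of_mul_of]
  rfl

theorem le_le_sup (m : ℕ) : le W m ≤ W ^ m ⊔ lt W m := by
  refine iSup₂_le fun j hj => ?_
  rcases hj.eq_or_lt with rfl | hj
  · exact le_sup_left
  · exact (pow_le_lt W hj).trans le_sup_right

theorem lt_eq_span {n : ℕ} (x : Fin n → A) (m : ℕ) :
    lt (Submodule.span k (Set.range x)) m = Submodule.span k (mon x '' {w | w.length < m}) := by
  simp only [lt, span_range_pow]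
  refine le_antisymm (iSup₂_le fun j hj => Submodule.span_mono (Set.image_mono ?_))
    (Submodule.span_le.2 ?_)
  · rintro w rfl
    exact hj
  · rintro _ ⟨w, hw, rfl⟩
    exact Submodule.mem_iSup_of_mem w.length
      (Submodule.mem_iSup_of_mem hw (Submodule.subset_span ⟨w, rfl, rfl⟩))

end GenFilt

section AssocGr

open GenFilt

variable {k A V : Type*} [Field k] [Ring A] [Algebra k A] [AddCommGroup V] [Module k V]
  (gen : V →ₗ[k] A) {n : ℕ} (b : Module.Basis (Fin n) k V)

/-- The canonical map `V → gr A`, as a linear map. -/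
noncomputable def assocGenₗ : V →ₗ[k] AssocGr gen where
  toFun := assocGen gen
  map_add' u v := by
    simp only [assocGen, grOf]
    rw [← map_add, ← map_add]
    exact lof_cls_congr _ rfl _ _ (map_add gen u v)
  map_smul' c v := by
    simp only [assocGen, grOf, RingHom.id_apply]
    rw [← map_smul, ← map_smul]
    exact lof_cls_congr _ rfl _ _ (map_smul gen c v)

theorem assocGenₗ_apply (v : V) : assocGenₗ gen v = assocGen gen v := rfl

theorem mon_mem_le (w : List (Fin n)) : mon (gen ∘ b) w ∈ le (LinearMap.range gen) w.length := by
  refine pow_le_le _ le_rfl ?_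
  rw [← genDeg, genDeg_eq_span_pow b, span_range_pow]
  exact Submodule.subset_span ⟨w, rfl, rfl⟩

theorem mon_assocGen (w : List (Fin n)) : mon (assocGen gen ∘ b) w =
    DirectSum.lof k ℕ (Comp (LinearMap.range gen)) w.length
      (cls _ w.length ⟨mon (gen ∘ b) w, mon_mem_le gen b w⟩) := by
  induction w with
  | nil => rfl
  | cons i w ih =>
    rw [mon_cons, ih]
    simp only [Function.comp_apply, assocGen, grOf]
    rw [lof_cls_mul_lof_cls]
    exact lof_cls_congr _ (by simp [add_comm]) _ _ (by simp [mulRep])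

theorem assocGrading_eq (m : ℕ) :
    assocGrading gen m = Submodule.span k (Set.range (assocGen gen ∘ b)) ^ m := by
  rw [span_range_pow]
  refine le_antisymm ?_ (Submodule.span_le.2 ?_)
  · rintro _ ⟨y, rfl⟩
    obtain ⟨⟨y, hy⟩, rfl⟩ := cls_surjective _ _ y
    -- Modulo lower degree, each class is represented by a sum of products of exactly `m`
    -- generators.
    obtain ⟨u, hu, v, hv, rfl⟩ := Submodule.mem_sup.1 (le_le_sup _ m hy)
    have hu' := pow_le_le _ (le_refl m) hu
    have e : cls (LinearMap.range gen) m ⟨u + v, hy⟩ = cls (LinearMap.range gen) m ⟨u, hu'⟩ := by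
      rw [← sub_eq_zero, ← map_sub, cls_eq_zero]
      simpa using hv
    rw [e]
    rw [← genDeg, genDeg_eq_span_pow b, span_range_pow] at hu
    have hle : Submodule.span k (mon (gen ∘ b) '' {w | w.length = m}) ≤
        le (LinearMap.range gen) m := by
      rw [← span_range_pow, ← genDeg_eq_span_pow]
      exact pow_le_le _ le_rfl
    refine Submodule.span_induction (p := fun u _ => ∀ hu', DirectSum.lof k ℕ
      (Comp (LinearMap.range gen)) m (cls (LinearMap.range gen) m ⟨u, hu'⟩) ∈
      Submodule.span k (mon (assocGen gen ∘ b) '' {w | w.length = m})) ?_ ?_ ?_ ?_ hu hu'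
    · rintro _ ⟨w, rfl, rfl⟩ hu'
      exact Submodule.subset_span ⟨w, rfl, mon_assocGen gen b w⟩
    · intro hu'
      have : (⟨0, hu'⟩ : le (LinearMap.range gen) m) = 0 := rfl
      rw [this, map_zero, map_zero]
      exact zero_mem _
    · intro y z hy hz ihy ihz hu'
      have : (⟨y + z, hu'⟩ : le (LinearMap.range gen) m) = ⟨y, hle hy⟩ + ⟨z, hle hz⟩ := rfl
      rw [this, map_add, map_add]
      exact add_mem (ihy _) (ihz _)
    · intro a y hy ihy hu'
      have : (⟨a • y, hu'⟩ : le (LinearMap.range gen) m) = a • ⟨y, hle hy⟩ := rfl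
      rw [this, map_smul, map_smul]
      exact Submodule.smul_mem _ _ (ihy _)
  · rintro _ ⟨w, rfl, rfl⟩
    rw [mon_assocGen]
    exact LinearMap.mem_range_self _ _

/-- A functional that vanishes on elements of degree less than `m` induces a functional on the
associated graded algebra. -/
theorem exists_functional_gr (m : ℕ) (f : A →ₗ[k] k)
    (hf : ∀ y ∈ lt (LinearMap.range gen) m, f y = 0) :
    ∃ F : AssocGr gen →ₗ[k] k, ∀ w : List (Fin n), F (mon (assocGen gen ∘ b) w) =
      if w.length = m then f (mon (gen ∘ b) w) else 0 := by
  let q : Comp (LinearMap.range gen) m →ₗ[k] k :=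
    Submodule.liftQ _ (f ∘ₗ (le (LinearMap.range gen) m).subtype) fun y hy => hf y hy
  refine ⟨q ∘ₗ DirectSum.component k ℕ _ m, fun w => ?_⟩
  rw [mon_assocGen, LinearMap.comp_apply]
  split_ifs with h
  · subst h
    rw [DirectSum.component.lof_self]
    rfl
  · rw [DirectSum.component.of, dif_neg h, map_zero]

end AssocGr

/-! ### Comparison with the abelian color Lie algebra -/

namespace ColorLieAlgebra

open TensorAlgebra

variable {k Γ : Type*} [Field k] [AddCommGroup Γ] {ε : CommutationFactor k Γ}
  {g : Type*} [AddCommGroup g] [Module k g] (L : ColorLieAlgebra ε g)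

theorem commRel_abelian (α β : Γ) (a c : g) :
    L.abelian.commRel α β a c = L.commRel α β a c + ι k (L.bracket a c) := by
  simp [commRel, abelian]

theorem commRel_abelian_mem (α β : Γ) (a c : g) :
    L.abelian.commRel α β a c ∈ tensorDeg k g 2 := by
  have h : ∀ u v : g, ι k u * ι k v ∈ tensorDeg k g 2 := fun u v => by
    rw [tensorDeg, pow_two]
    exact Submodule.mul_mem_mul (LinearMap.mem_range_self _ u) (LinearMap.mem_range_self _ v)
  simpa [commRel, abelian] using sub_mem (h a c) (Submodule.smul_mem _ _ (h c a))

theorem ι_mem_tensorDeg (v : g) : ι k v ∈ tensorDeg k g 1 := by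
  rw [tensorDeg, pow_one]; exact LinearMap.mem_range_self _ v

theorem quadRel_commRel_abelian {α β : Γ} {a c : g} (ha : a ∈ L.comp α) (hc : c ∈ L.comp β) :
    quadRel L.relations (L.abelian.commRel α β a c) 0 := by
  refine ⟨L.commRel_abelian_mem α β a c, ⟨-ι k (L.bracket a c), neg_mem (ι_mem_tensorDeg _), ?_⟩,
    rfl⟩
  rw [commRel_abelian, add_neg_cancel_right]
  exact L.commRel_mem_relations ha hc

theorem exists_add_mem_relations_abelian {y : TensorAlgebra k g} (hy : y ∈ L.relations) :
    ∃ l ∈ tensorDeg k g 1, y + l ∈ L.abelian.relations := by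
  refine Submodule.span_induction
    (p := fun y _ => ∃ l ∈ tensorDeg k g 1, y + l ∈ L.abelian.relations) ?_ ?_ ?_ ?_ hy
  · rintro _ ⟨α, β, a, ha, c, hc, rfl⟩
    refine ⟨ι k (L.bracket a c), ι_mem_tensorDeg _, ?_⟩
    rw [← commRel_abelian]
    exact L.abelian.commRel_mem_relations ha hc
  · exact ⟨0, zero_mem _, by simp⟩
  · rintro y z _ _ ⟨l, hl, hyl⟩ ⟨l', hl', hzl⟩
    refine ⟨l + l', add_mem hl hl', ?_⟩
    rw [add_add_add_comm]
    exact add_mem hyl hzl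
  · rintro a y _ ⟨l, hl, hyl⟩
    refine ⟨a • l, Submodule.smul_mem _ a hl, ?_⟩
    rw [← smul_add]
    exact Submodule.smul_mem _ a hyl

theorem relations_abelian_le : L.abelian.relations ≤ tensorDeg k g 2 := by
  refine Submodule.span_le.2 ?_
  rintro _ ⟨α, β, a, ha, c, hc, rfl⟩
  exact L.commRel_abelian_mem α β a c

theorem disjoint_tensorDeg {i j : ℕ} (hij : i ≠ j) :
    Disjoint (tensorDeg k g i) (tensorDeg k g j) :=
  (DirectSum.Decomposition.isInternal (tensorDeg k g)).submodule_iSupIndep.pairwiseDisjoint hij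

/-- Adding linear terms carries `y` to a relation of `L` and then to one of `L.abelian`. The latter
is purely quadratic, as is `y`, so the total linear correction is zero. -/
theorem mem_relations_abelian_of_quadRel {y z : TensorAlgebra k g}
    (h : quadRel L.relations y z) : y ∈ L.abelian.relations := by
  obtain ⟨hy, ⟨l, hl, hyl⟩, -⟩ := h
  obtain ⟨l', hl', h'⟩ := L.exists_add_mem_relations_abelian hyl
  have h1 : l + l' ∈ tensorDeg k g 2 := by
    have := sub_mem (L.relations_abelian_le h') hy
    rwa [show y + l + l' - y = l + l' by abel] at this
  have h0 := Submodule.disjoint_def.1 (disjoint_tensorDeg (k := k) (g := g) (Nat.succ_ne_self 1).symm) _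
    (add_mem hl hl') h1
  rwa [add_assoc, h0, add_zero] at h'

/-- The homogeneous quadratic algebra of `U(g)` is the enveloping algebra of the abelian color Lie
algebra. -/
theorem gradedIso_quadAlg : GradedIso (genDeg (quadGen L.relations)) (genDeg L.abelian.envι)
    (quadGen L.relations) L.abelian.envι := by
  let φ : QuadAlg L.relations →ₐ[k] L.abelian.Env := RingQuot.liftAlgHom k
    ⟨TensorAlgebra.lift k L.abelian.envι, fun y z h => by
      have := L.mem_relations_abelian_of_quadRel h
      rw [h.2.2, map_zero, lift_envι_eq_zero]
      exact TwoSidedIdeal.subset_span this⟩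
  let ψ : L.abelian.Env →ₐ[k] QuadAlg L.relations := RingQuot.liftAlgHom k
    ⟨RingQuot.mkAlgHom k (quadRel L.relations), fun y z h => by
      obtain ⟨ha, hc⟩ := h
      rw [← sub_eq_zero, ← map_sub, ← sub_sub]
      exact (RingQuot.mkAlgHom_rel k (L.quadRel_commRel_abelian ha hc)).trans (map_zero _)⟩
  have hφ : ∀ v, φ (quadGen L.relations v) = L.abelian.envι v := fun v => by
    simp only [φ, quadGen, LinearMap.comp_apply, AlgHom.toLinearMap_apply]
    rw [RingQuot.liftAlgHom_mkAlgHom_apply, TensorAlgebra.lift_ι_apply]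
  have hψ : ∀ v, ψ (L.abelian.envι v) = quadGen L.relations v := fun v => by
    simp only [ψ, envι, quadGen, LinearMap.comp_apply, AlgHom.toLinearMap_apply]
    rw [RingQuot.liftAlgHom_mkAlgHom_apply]
  let e : QuadAlg L.relations ≃ₐ[k] L.abelian.Env := AlgEquiv.ofAlgHom φ ψ
    (by
      apply RingQuot.ringQuot_ext'
      ext v
      exact (congrArg φ (hψ v)).trans (hφ v))
    (by
      apply RingQuot.ringQuot_ext'
      ext v
      exact (congrArg ψ (hφ v)).trans (hψ v))
  refine ⟨e, hφ, fun m => ?_⟩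
  have hmap : (LinearMap.range (quadGen L.relations)).map φ.toLinearMap =
      LinearMap.range L.abelian.envι := by
    rw [← LinearMap.range_comp]
    congr 1
    ext v
    exact hφ v
  rw [genDeg, genDeg, ← hmap]
  exact Submodule.map_pow _ φ m

/-! ### Coordinates by normal words and their transfer to the graded algebras -/

section Basis

variable {n : ℕ} {b : Module.Basis (Fin n) k g} {deg : Fin n → Γ}
  (hb : ∀ i, b i ∈ L.comp (deg i)) (h2 : (2 : k) ≠ 0) (h3 : (3 : k) ≠ 0)

theorem lift_envι_mon (w : List (Fin n)) :
    TensorAlgebra.lift k L.envι (mon (letter b) w) = mon (L.envι ∘ b) w := by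
  rw [map_mon]
  congr 1
  ext i
  simp [letter]

include hb h2 h3

/-- Coordinates of elements of the enveloping algebra with respect to the normal words. -/
theorem exists_coordinate (v : List (Fin n)) : ∃ f : L.Env →ₗ[k] k,
    (∀ w, NormalWord (Defect ε deg) w → f (mon (L.envι ∘ b) w) = if w = v then 1 else 0) ∧
    ∀ w, f (mon (L.envι ∘ b) w) ≠ 0 → v.length ≤ w.length := by
  obtain ⟨N, hN1, hN2, -, hN4⟩ := L.exists_normalForm h2 h3 hb
  obtain ⟨s, hs⟩ := (TensorAlgebra.lift k L.envι).toLinearMap.exists_rightInverse_of_surjective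
    (LinearMap.range_eq_top.2 L.lift_envι_surjective)
  have hNs : ∀ y, N (s (TensorAlgebra.lift k L.envι y)) = N y := fun y => by
    rw [← sub_eq_zero, ← map_sub]
    refine hN4 _ ?_
    rw [← lift_envι_eq_zero, map_sub, sub_eq_zero]
    exact LinearMap.congr_fun hs _
  -- The coefficient of `v` in the normal form; the choice of the section `s` is immaterial because
  -- `N` kills the ideal of relations.
  refine ⟨b.tensorAlgebra.coord (FreeMonoid.ofList v) ∘ₗ N ∘ₗ s, fun w hw => ?_, fun w hw => ?_⟩
  · rw [← lift_envι_mon, LinearMap.comp_apply, LinearMap.comp_apply, hNs, hN1 w hw,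
      Module.Basis.coord_apply, repr_mon_letter]
    classical
    rw [Finsupp.single_apply]
    congr 1
  · rw [← lift_envι_mon, LinearMap.comp_apply, LinearMap.comp_apply, hNs,
      Module.Basis.coord_apply] at hw
    rcases ((mem_span_mon_letter b).1 (hN2 w) _ hw).2.1 with h | h
    · exact (congrArg List.length h).le
    · exact h.length_le

/-- With zero bracket the length clause in `normalWords` takes effect, so the normal form is
homogeneous and the Anick resolution applies. -/
theorem quadraticStraightening_abelian :
    QuadraticStraightening k (L.abelian.envι ∘ b) (Defect ε deg) := by
  have hb' : ∀ i, b i ∈ L.abelian.comp (deg i) := hb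
  refine ⟨?_, ?_, fun w => ?_⟩
  · rw [linearIndependent_iff']
    intro s c hc v hv
    obtain ⟨f, hf, -⟩ := L.abelian.exists_coordinate hb' h2 h3 v.1
    have h1 := congrArg f hc
    rw [map_sum, map_zero, Finset.sum_eq_single v] at h1
    · rw [map_smul, hf _ v.2, if_pos rfl, smul_eq_mul, mul_one] at h1
      exact h1
    · intro w _ hwv
      rw [map_smul, hf _ w.2, if_neg fun h => hwv (Subtype.ext h), smul_zero]
    · exact fun h => absurd hv h
  · have hr : Set.range (mon (L.abelian.envι ∘ b)) =
        (TensorAlgebra.lift k L.abelian.envι).toLinearMap '' Set.range (mon (letter b)) := by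
      rw [← Set.range_comp]
      congr 1
      ext w
      exact (L.abelian.lift_envι_mon w).symm
    rw [hr, ← Submodule.map_span, span_mon_letter, Submodule.map_top, LinearMap.range_eq_top]
    exact L.abelian.lift_envι_surjective
  · obtain ⟨N, -, hN2, hN3, -⟩ := L.abelian.exists_normalForm h2 h3 hb'
    have h1 : mon (L.abelian.envι ∘ b) w =
        (TensorAlgebra.lift k L.abelian.envι).toLinearMap (N (mon (letter b) w)) := by
      rw [← lift_envι_mon, ← sub_eq_zero, AlgHom.toLinearMap_apply, ← map_sub, lift_envι_eq_zero]
      exact hN3 _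
    rw [h1]
    have h4 := Submodule.mem_map_of_mem
      (f := (TensorAlgebra.lift k L.abelian.envι).toLinearMap) (hN2 w)
    rw [Submodule.map_span] at h4
    refine Submodule.span_mono ?_ h4
    rintro _ ⟨_, ⟨v, ⟨hv, hvw, hl⟩, rfl⟩, rfl⟩
    exact ⟨v, ⟨hv, hl rfl, hvw⟩, (L.abelian.lift_envι_mon v).symm⟩

omit hb h2 h3 in
-- The bracket has degree one, so it vanishes in the component of degree two.
theorem assocGen_comm {α β : Γ} {a c : g} (ha : a ∈ L.comp α) (hc : c ∈ L.comp β) :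
    assocGen L.envι a * assocGen L.envι c =
      (ε α β : k) • (assocGen L.envι c * assocGen L.envι a) := by
  simp only [assocGen, GenFilt.grOf]
  rw [GenFilt.lof_cls_mul_lof_cls, GenFilt.lof_cls_mul_lof_cls, ← map_smul, ← map_smul,
    ← sub_eq_zero, ← map_sub, ← map_sub]
  rw [(GenFilt.cls_eq_zero _).2, map_zero]
  have h1 := L.lift_envι_commRel ha hc
  rw [commRel, map_sub, map_sub, map_smul, map_mul, map_mul, sub_eq_zero] at h1
  simp only [TensorAlgebra.lift_ι_apply] at h1
  have h2 : L.envι (L.bracket a c) ∈ GenFilt.lt (LinearMap.range L.envι) (1 + 1) :=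
    GenFilt.pow_le_lt _ one_lt_two (by rw [pow_one]; exact LinearMap.mem_range_self _ _)
  rw [← h1] at h2
  exact h2

/-- The associated graded algebra of `U(g)` is the enveloping algebra of the abelian color Lie
algebra. -/
theorem gradedIso_assocGr : GradedIso (genDeg L.abelian.envι) (assocGrading L.envι)
    L.abelian.envι (assocGen L.envι) := by
  let φ : L.abelian.Env →ₐ[k] AssocGr L.envι := RingQuot.liftAlgHom k
    ⟨TensorAlgebra.lift k (assocGenₗ L.envι), fun y z h => by
      obtain ⟨ha, hc⟩ := h
      simp only [map_mul, map_smul, TensorAlgebra.lift_ι_apply, assocGenₗ_apply,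
        abelian, LinearMap.zero_apply, map_zero, add_zero]
      exact L.assocGen_comm ha hc⟩
  have hφ : ∀ v, φ (L.abelian.envι v) = assocGen L.envι v := fun v => by
    have : L.abelian.envι v = RingQuot.mkAlgHom k L.abelian.EnvRel (ι k v) := rfl
    rw [this, RingQuot.liftAlgHom_mkAlgHom_apply, TensorAlgebra.lift_ι_apply, assocGenₗ_apply]
  have hφb : φ ∘ (L.abelian.envι ∘ b) = assocGen L.envι ∘ b := funext fun i => hφ (b i)
  have hmap : ∀ m, (genDeg L.abelian.envι m).map φ.toLinearMap = assocGrading L.envι m :=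
    fun m => by
      rw [genDeg_eq_span_pow b, map_span_range_pow, hφb, assocGrading_eq L.envι b]
  have hinj : Function.Injective φ := by
    rw [injective_iff_map_eq_zero]
    intro y hy
    have h := L.quadraticStraightening_abelian hb h2 h3
    refine h.basis.ext_elem fun v => ?_
    -- The coordinate of `v` is taken on `U(g)` itself. It vanishes on shorter words, hence descends
    -- to `gr U(g)`, and pulled back along `φ` it is the coordinate of the same word on `U(g_ab)`.
    obtain ⟨f, hf, hf'⟩ := L.exists_coordinate hb h2 h3 v.1
    obtain ⟨F, hF⟩ := exists_functional_gr L.envι b v.1.length f (by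
      have hW : LinearMap.range L.envι = Submodule.span k (Set.range (L.envι ∘ b)) := by
        rw [← pow_one (LinearMap.range L.envι), ← genDeg, genDeg_eq_span_pow b, pow_one]
      rw [hW, GenFilt.lt_eq_span]
      intro z hz
      refine Submodule.span_le (p := LinearMap.ker f) |>.2 ?_ hz
      rintro _ ⟨w, hw, rfl⟩
      by_contra hne
      exact absurd (hf' w hne) (not_le.2 hw))
    have hcoord : F ∘ₗ φ.toLinearMap = h.basis.coord v := by
      refine h.basis.ext fun w => ?_
      rw [h.basis_apply, LinearMap.comp_apply, AlgHom.toLinearMap_apply, map_mon, hφb, hF,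
        ← h.basis_apply, Module.Basis.coord_apply, Module.Basis.repr_self, Finsupp.single_apply,
        hf _ w.2]
      by_cases hwv : w = v
      · subst hwv
        simp
      · simp [hwv, Subtype.coe_inj]
    have := LinearMap.congr_fun hcoord y
    rw [LinearMap.comp_apply, AlgHom.toLinearMap_apply, hy, map_zero,
      Module.Basis.coord_apply] at this
    rw [← this, map_zero, Finsupp.zero_apply]
  have hsurj : Function.Surjective φ := by
    rw [← AlgHom.coe_toLinearMap, ← LinearMap.range_eq_top, eq_top_iff]
    intro y _
    induction y using DirectSum.induction_on with
    | zero => exact zero_mem _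
    | of m y =>
      have : DirectSum.of _ m y ∈ assocGrading L.envι m := ⟨y, rfl⟩
      rw [← hmap] at this
      exact LinearMap.map_le_range this
    | add y z hy hz => exact add_mem (hy trivial) (hz trivial)
  exact ⟨AlgEquiv.ofBijective φ ⟨hinj, hsurj⟩, hφ, hmap⟩

/-- A graded algebra isomorphic to the enveloping algebra of an abelian color Lie algebra is
Koszul. -/
theorem isHomogeneousKoszul_of_gradedIso {A : Type*} [Ring A] [Algebra k A]
    {𝒜 : ℕ → Submodule k A} {gen : g → A}
    (h : GradedIso (genDeg L.abelian.envι) 𝒜 L.abelian.envι gen) : IsHomogeneousKoszul 𝒜 := by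
  obtain ⟨e, -, hm⟩ := h
  have h𝒜 : 𝒜 = fun m => Submodule.span k (Set.range (e ∘ (L.abelian.envι ∘ b))) ^ m := by
    funext m
    rw [← hm, genDeg_eq_span_pow b]
    exact map_span_range_pow (e : L.abelian.Env →ₐ[k] A) _ m
  rw [h𝒜]
  exact ((L.quadraticStraightening_abelian hb h2 h3).map e).isHomogeneousKoszul

end Basis

end ColorLieAlgebra

/-! ### The main theorem -/

theorem mainTheorem2 {k : Type*} [Field k] (h2 : (2 : k) ≠ 0) (h3 : (3 : k) ≠ 0)
    {Γ : Type*} [AddCommGroup Γ] (ε : CommutationFactor k Γ)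
    {g : Type*} [AddCommGroup g] [Module k g] [FiniteDimensional k g]
    (L : ColorLieAlgebra ε g) :
    IsAlmostQuadratic L.envι L.relations ∧
    IsPBW L.envι L.relations ∧
    (∀ (n : ℕ) (b : Module.Basis (Fin n) k g) (deg : Fin n → Γ),
      (∀ i, b i ∈ L.comp (deg i)) →
        LinearIndependent k (L.basisRel b deg) ∧
        Submodule.span k (Set.range (L.basisRel b deg)) = L.relations ∧
        IsGroebnerBasis b (Set.range (L.basisRel b deg))
          (TwoSidedIdeal.ker (TensorAlgebra.lift k L.envι))) ∧
    IsKoszulAlmostQuadratic L.envι L.relations ∧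
    GradedIso (assocGrading L.envι) (genDeg L.abelian.envι)
      (assocGen L.envι) L.abelian.envι ∧
    GradedIso (genDeg (quadGen L.relations)) (genDeg L.abelian.envι)
      (quadGen L.relations) L.abelian.envι := by
  obtain ⟨n, b, deg, hb⟩ := L.exists_homogeneous_basis
  have hgr := L.gradedIso_assocGr hb h2 h3
  have hquad := L.gradedIso_quadAlg
  exact ⟨L.isAlmostQuadratic h2 h3, L.isPBW h2 h3,
    fun n b deg hb => ⟨L.linearIndependent_basisRel h2, L.span_basisRel hb h2,
      L.isGroebnerBasis hb h2 h3⟩,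
    ⟨L.isAlmostQuadratic h2 h3, hquad.trans hgr,
      L.isHomogeneousKoszul_of_gradedIso hb h2 h3 hquad.symm,
      L.isHomogeneousKoszul_of_gradedIso hb h2 h3 hgr⟩,
    hgr.symm, hquad⟩
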